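/- Let $k\ge 1$ be an integer. Let $\left\{{n\atop j}\right\}$ denote the Stirling numbers of the second kind, and put $$a_k(m)=\sum_{j=0}^{2k-1} j!\,(-1)^j\left\{{2k-1\atop j}\right\}\binom{j}{m},\qquad b_k(\ell)=\sum_{m=0}^{2k-1}(-1)^m a_k(m)\binom{2k-m-1}{\ell},$$ $$P^e_{2k-2}(z)=\sum_{\ell=1}^{2k-1}(-1)^\ell b_k(\ell)z^{\ell-1},\qquad P^o_{4k-2}(z)=(1+z)^{2k}P^e_{2k-2}(z)-2^{2k-1}z\,P^e_{2k-2}(z^2).$$ For $q\in\mathbb{C}$ with $|q|<1$ define $$\mathcal{G}_{2k}(q)=\begin{cases}\displaystyle\sum_{n=0}^\infty\frac{q^{2n+1}P^o_{4k-2}(q^{2n+1})}{(1-q^{4n+2})^{2k}}, & k\text{ odd},\\[3mm] \displaystyle 2^{2k-1}\sum_{n=0}^\infty\frac{q^{4n+2}P^e_{2k-2}(q^{4n+2})}{(1-q^{4n+2})^{2k}}, & k\text{ even}.\end{cases}$$ Let $\mathcal{Z}(2k)=-\dfrac{(-16)^kB_{2k}(4^k-1)}{8k}$, where $B_{2k}$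 is the Bernoulli number, and let $(x;q)_\infty=\prod_{n\ge 0}(1-xq^n)$. Then there are unique rational numbers $\alpha_{2k}(1),\dots,\alpha_{2k}(k-1)$ (none if $k=1$) such that, for all $q\in\mathbb{C}$ with $|q|<1$, $$\sum_{j=1}^{k-1}\alpha_{2k}(j)\,\frac{q^j(q^4;q^4)_\infty^{16j}(q;q)_\infty^{8j}}{(q^2;q^2)_\infty^{24j}}=\left(\mathcal{G}_{2k}(q)-\mathcal{Z}(2k)\frac{q^k(q^4;q^4)_\infty^{8k}}{(q^2;q^2)_\infty^{4k}}\right)\frac{(q;q)_\infty^{8k}(q^4;q^4)_\infty^{8k}}{(q^2;q^2)_\infty^{20k}},$$ and, with $a=\sqrt2-1$, these numbers satisfy $$\mathcal{G}_{2k}(e^{-\pi})=\left(\frac{\mathcal{Z}(2k)}{2^{7k}}+\frac{1}{2^{2k}}\sum_{j=1}^{k-1}\frac{\alpha_{2k}(j)}{2^{5j}}\right)\left(\frac{\Gamma(1/4)^4}{\pi^3}\right)^k,$$ $$\mathcal{G}_{2k}(e^{-2\pi})=\left(\frac{\mathcal{Z}(2k)\,a^{2k}}{2^{9k}}+\frac{1}{2^{5k}a^{2k}}\sum_{j=1}^{k-1}\frac{\alpha_{2k}(j)\,a^{4j}}{2^{4j}}\right)\left(\frac{\Gamma(1/4)^4}{\pi^3}\right)^k.$$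 -/

import Mathlib

noncomputable section

namespace Goswami

open scoped Polynomial
open Polynomial (C X aeval)

/-- The integers `a_k(m) = ∑_{j=0}^{2k-1} j! (-1)^j S(2k-1, j) (j choose m)`, where `S` denotes the
Stirling numbers of the second kind. -/
def a (k m : ℕ) : ℤ :=
  ∑ j ∈ Finset.range (2 * k),
    (j.factorial : ℤ) * (-1) ^ j * (Nat.stirlingSecond (2 * k - 1) j : ℤ) * (j.choose m : ℤ)

/-- The integers `b_k(ℓ) = ∑_{m=0}^{2k-1} (-1)^m a_k(m) (2k-m-1 choose ℓ)`. -/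
def b (k l : ℕ) : ℤ :=
  ∑ m ∈ Finset.range (2 * k), (-1) ^ m * a k m * ((2 * k - m - 1).choose l : ℤ)

/-- The polynomial `P^e_{2k-2}(z) = ∑_{ℓ=1}^{2k-1} (-1)^ℓ b_k(ℓ) z^{ℓ-1}`. -/
def Pe (k : ℕ) : ℤ[X] :=
  ∑ l ∈ Finset.Icc 1 (2 * k - 1), C ((-1) ^ l * b k l) * X ^ (l - 1)

/-- The polynomial `P^o_{4k-2}(z) = (1+z)^{2k} P^e_{2k-2}(z) - 2^{2k-1} z P^e_{2k-2}(z^2)`. -/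
def Po (k : ℕ) : ℤ[X] :=
  (1 + X) ^ (2 * k) * Pe k - 2 ^ (2 * k - 1) * X * (Pe k).comp (X ^ 2)

/-- The `n`-th summand of the `q`-series `𝒢_{2k}(q)`. -/
def term (k : ℕ) (q : ℂ) (n : ℕ) : ℂ :=
  if Odd k then
    q ^ (2 * n + 1) * aeval (q ^ (2 * n + 1)) (Po k) / (1 - q ^ (4 * n + 2)) ^ (2 * k)
  else
    2 ^ (2 * k - 1) *
      (q ^ (4 * n + 2) * aeval (q ^ (4 * n + 2)) (Pe k) / (1 - q ^ (4 * n + 2)) ^ (2 * k))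

/-- The series `𝒢_{2k}(q)`, for `|q| < 1`. -/
def G (k : ℕ) (q : ℂ) : ℂ := ∑' n : ℕ, term k q n

/-- The rational number `𝒵(2k) = -(-16)^k B_{2k} (4^k - 1) / (8k)`. -/
def Z (k : ℕ) : ℚ := -((-16) ^ k * bernoulli (2 * k) * (4 ^ k - 1) / (8 * k))

/-- The infinite `q`-Pochhammer symbol `(x; q)_∞ = ∏_{n ≥ 0} (1 - x q^n)`, for `|q| < 1`. -/
def qPoch (x q : ℂ) : ℂ := ∏' n : ℕ, (1 - x * q ^ n)

/-- The numbers `α 1, …, α (k-1)` (the other values of `α` play no role) satisfy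
`∑_{j=1}^{k-1} α(j) q^j (q^4;q^4)^{16j} (q;q)^{8j} / (q^2;q^2)^{24j}
  = (𝒢_{2k}(q) - 𝒵(2k) q^k (q^4;q^4)^{8k} / (q^2;q^2)^{4k})
      (q;q)^{8k} (q^4;q^4)^{8k} / (q^2;q^2)^{20k}`
for all `q` in the open unit disc. -/
def IsCuspCoeff (k : ℕ) (α : ℕ → ℚ) : Prop :=
  ∀ q : ℂ, ‖q‖ < 1 →
    ∑ j ∈ Finset.Icc 1 (k - 1), (α j : ℂ) *
        (q ^ j * qPoch (q ^ 4) (q ^ 4) ^ (16 * j) * qPoch q q ^ (8 * j)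
          / qPoch (q ^ 2) (q ^ 2) ^ (24 * j)) =
      (G k q - (Z k : ℂ) *
          (q ^ k * qPoch (q ^ 4) (q ^ 4) ^ (8 * k) / qPoch (q ^ 2) (q ^ 2) ^ (4 * k))) *
        (qPoch q q ^ (8 * k) * qPoch (q ^ 4) (q ^ 4) ^ (8 * k)
          / qPoch (q ^ 2) (q ^ 2) ^ (20 * k))

/-- The series defining `𝒢_{2k}(q)` converges absolutely in the open unit disc. -/
theorem summable_term (k : ℕ) {q : ℂ} (hq : ‖q‖ < 1) : Summable (term k q) := by
  have hg : Summable fun n : ℕ => ‖q‖ ^ n := summable_geometric_of_lt_one (norm_nonneg _) hq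
  have h0 := tendsto_pow_atTop_nhds_zero_of_norm_lt_one hq
  have h1 : Filter.Tendsto (fun n : ℕ => q ^ (2 * n + 1)) Filter.atTop (nhds 0) :=
    h0.comp (Filter.tendsto_atTop_mono (fun n => by simp only [id]; lia) Filter.tendsto_id)
  have h2 : Filter.Tendsto (fun n : ℕ => q ^ (4 * n + 2)) Filter.atTop (nhds 0) :=
    h0.comp (Filter.tendsto_atTop_mono (fun n => by simp only [id]; lia) Filter.tendsto_id)
  have key : ∀ (P : ℤ[X]) (u : ℕ → ℕ), (∀ n, n ≤ u n) →
      Summable fun n => q ^ u n * aeval (q ^ u n) P / (1 - q ^ (4 * n + 2)) ^ (2 * k) := by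
    intro P u hu
    have hu0 : Filter.Tendsto (fun n : ℕ => q ^ u n) Filter.atTop (nhds 0) :=
      h0.comp (Filter.tendsto_atTop_mono hu Filter.tendsto_id)
    have hP : Filter.Tendsto
        (fun n : ℕ => aeval (q ^ u n) P / (1 - q ^ (4 * n + 2)) ^ (2 * k))
        Filter.atTop (nhds (aeval (0 : ℂ) P / (1 - 0) ^ (2 * k))) :=
      Filter.Tendsto.div ((P.continuous_aeval.tendsto 0).comp hu0)
        ((tendsto_const_nhds.sub h2).pow _) (by simp)
    have hO := hP.isBigO_one ℝ
    refine summable_of_isBigO_nat hg ?_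
    have hO2 : (fun n : ℕ => q ^ u n) =O[Filter.atTop] fun n => ‖q‖ ^ n := by
      refine Asymptotics.isBigO_of_le _ fun n => ?_
      rw [norm_pow, norm_pow, norm_norm]
      exact pow_le_pow_of_le_one (norm_nonneg _) hq.le (hu n)
    simpa [mul_div_assoc] using hO2.mul hO
  by_cases hk : Odd k
  · refine (key (Po k) (fun n => 2 * n + 1) (fun n => by lia)).congr fun n => ?_
    rw [term, if_pos hk]
  · refine ((key (Pe k) (fun n => 4 * n + 2) (fun n => by lia)).mul_left
      (2 ^ (2 * k - 1))).congr fun n => ?_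
    rw [term, if_neg hk]

/-- The product defining `(x; q)_∞` converges for `|q| < 1`. -/
theorem multipliable_qPoch (x : ℂ) {q : ℂ} (hq : ‖q‖ < 1) :
    Multipliable fun n : ℕ => 1 - x * q ^ n := by
  have h : Summable fun n : ℕ => ‖-(x * q ^ n)‖ := by
    simpa [norm_mul] using
      (summable_geometric_of_lt_one (norm_nonneg _) hq).mul_left ‖x‖
  simpa [sub_eq_add_neg] using multipliable_one_add_of_summable h

end Goswami

end

/-! Expanding every summand of `G` turns it into a Lambert series: twice `G k q` is the moment of
order 2k-1 of `sinhCoeff q` over the odd integers (k odd) or the even integers (k even). These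
moments are read off at u = 0 from Fourier series of elliptic functions: S = `jacS q` in the odd
case, and the even-frequency part of W², W = `jacW q`, in the even case.

Partial fractions for products of the hyperbolic coefficients make the convolutions explicit. They
give W' = 2iSW and S' = (i/2)(W(u)² - W(u+π)²), with first integrals W(u)W(u+π) and W(u)² + W(u+π)²
- 4S². Hence -d²/du² acts on polynomials in S as `lameOp`, whose parameters are polynomials in F =
`formF q` and T = `formT q`. Since S(0) = 0, the moments are coefficients of iterates of `lameOp`,
homogeneous in F and T with rational coefficients (`exists_G_eq_sum`). The coefficient of F^k is
isolated by T = 0, F = 1. There `lameOp` is the action of d²/du² on polynomials in tanh(2u), and the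
Taylor coefficients of tanh(2u) bring in the Bernoulli number in `Z k`.

The values W(0), W(π) undergo an arithmetic-geometric mean step under q ↦ q². Comparison with
product identities, together with the behaviour at q → 0, identifies T and F with eta quotients
(`formT_eq`, `formF_eq`). The relation in `IsCuspCoeff` is then the expansion of `G k q` divided by
T^k. Uniqueness holds because F/T takes infinitely many values.

For the special values, eta inversion between 2i and i/2 gives T = 32F at e^{-π}. This makes the
elliptic function of nome e^{-π/2} lemniscatic: its descent from maximum to zero takes time π/2 by
the Fourier series, and a multiple of B(1/4, 1/2) by the differential equation (`jacW_sub_sq`). This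
evaluates T at e^{-π}, and one more mean step gives the values at e^{-2π}. -/

noncomputable section

namespace Goswami

open Complex Filter Topology

/-! ### Fourier series with rapidly decaying coefficients -/

/-- A bilateral sequence all of whose polynomial moments converge absolutely. -/
def Rapid (a : ℤ → ℂ) : Prop := ∀ k : ℕ, Summable fun n : ℤ => ‖(n : ℂ) ^ k * a n‖

/-- The Fourier series with coefficients `a`. -/
def fser (a : ℤ → ℂ) (u : ℝ) : ℂ := ∑' n : ℤ, a n * cexp (I * n * u)

theorem norm_cexp_I_int (n : ℤ) (u : ℝ) : ‖cexp (I * n * u)‖ = 1 := by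
  have : I * n * u = ((n * u : ℝ) : ℂ) * I := by push_cast; ring
  rw [this, norm_exp_ofReal_mul_I]

theorem Rapid.summable_norm {a : ℤ → ℂ} (ha : Rapid a) : Summable fun n => ‖a n‖ := by
  simpa using ha 0

theorem Rapid.summable {a : ℤ → ℂ} (ha : Rapid a) : Summable a := ha.summable_norm.of_norm

theorem Rapid.int_mul {a : ℤ → ℂ} (ha : Rapid a) : Rapid fun n => n * a n := by
  intro k
  refine (ha (k + 1)).congr fun n => ?_
  rw [pow_succ, mul_assoc]

theorem Rapid.of_norm_le {a b : ℤ → ℂ} (ha : Rapid a) (h : ∀ n, ‖b n‖ ≤ ‖a n‖) : Rapid b := by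
  intro k
  refine (ha k).of_nonneg_of_le (fun n => norm_nonneg _) fun n => ?_
  rw [norm_mul, norm_mul]
  exact mul_le_mul_of_nonneg_left (h n) (norm_nonneg _)

theorem Rapid.const_mul {a : ℤ → ℂ} (ha : Rapid a) (c : ℂ) : Rapid fun n => c * a n := by
  intro k
  refine ((ha k).mul_left ‖c‖).congr fun n => ?_
  simp only [norm_mul]; ring

theorem rapid_of_geometric {a : ℤ → ℂ} {K r : ℝ} (hr0 : 0 ≤ r) (hr : r < 1)
    (h : ∀ n : ℤ, ‖a n‖ ≤ K * r ^ n.natAbs) : Rapid a := by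
  intro k
  have hs : Summable fun n : ℕ => K * ((n : ℝ) ^ k * r ^ n) :=
    (summable_pow_mul_geometric_of_norm_lt_one k
      (by rwa [Real.norm_of_nonneg hr0])).mul_left K
  refine Summable.of_nat_of_neg (hs.of_nonneg_of_le (fun _ => norm_nonneg _) fun n => ?_)
    (hs.of_nonneg_of_le (fun _ => norm_nonneg _) fun n => ?_)
  · have := h n
    simp only [Int.natAbs_natCast] at this
    simp only [Int.cast_natCast, norm_mul, norm_pow, Complex.norm_natCast]
    nlinarith [pow_nonneg (Nat.cast_nonneg n : (0 : ℝ) ≤ n) k]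
  · have := h (-n)
    simp only [Int.natAbs_neg, Int.natAbs_natCast] at this
    simp only [Int.cast_neg, Int.cast_natCast, norm_mul, norm_pow, norm_neg, Complex.norm_natCast]
    nlinarith [pow_nonneg (Nat.cast_nonneg n : (0 : ℝ) ≤ n) k]

theorem Rapid.summable_fser {a : ℤ → ℂ} (ha : Rapid a) (u : ℝ) :
    Summable fun n : ℤ => a n * cexp (I * n * u) := by
  refine Summable.of_norm (ha.summable_norm.congr fun n => ?_)
  rw [norm_mul, norm_cexp_I_int, mul_one]

theorem Rapid.hasSum_fser {a : ℤ → ℂ} (ha : Rapid a) (u : ℝ) :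
    HasSum (fun n : ℤ => a n * cexp (I * n * u)) (fser a u) := (ha.summable_fser u).hasSum

theorem Rapid.hasDerivAt_fser {a : ℤ → ℂ} (ha : Rapid a) (u : ℝ) :
    HasDerivAt (fser a) (I * fser (fun n => n * a n) u) u := by
  have h := hasDerivAt_tsum (u := fun n : ℤ => ‖(n : ℂ) ^ 1 * a n‖)
    (g := fun (n : ℤ) (u : ℝ) => a n * cexp (I * n * u))
    (g' := fun (n : ℤ) (u : ℝ) => I * (n * a n * cexp (I * n * u))) (ha 1) (fun n y => ?_)
    (fun n y => ?_) (ha.summable_fser 0) u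
  · rw [fser, ← tsum_mul_left]
    exact h
  · have h1 : HasDerivAt (fun z : ℂ => a n * cexp (I * n * z))
        (a n * (cexp (I * n * y) * (I * n * 1))) (y : ℂ) :=
      (((hasDerivAt_id (y : ℂ)).const_mul (I * n)).cexp).const_mul (a n)
    refine h1.comp_ofReal.congr_deriv ?_
    ring
  · rw [norm_mul, norm_mul, norm_cexp_I_int, norm_I, pow_one, one_mul, mul_one]

theorem fser_const_mul (c : ℂ) (a : ℤ → ℂ) (u : ℝ) :
    fser (fun n => c * a n) u = c * fser a u := by
  rw [fser, fser, ← tsum_mul_left]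
  simp only [mul_assoc]

theorem fser_zero (a : ℤ → ℂ) : fser a 0 = ∑' n, a n := by simp [fser]

theorem cexp_I_int_add_pi (n : ℤ) (u : ℝ) :
    cexp (I * n * ((u + Real.pi : ℝ) : ℂ)) = (if Odd n then -1 else 1) * cexp (I * n * u) := by
  have : I * n * ((u + Real.pi : ℝ) : ℂ) = I * n * u + n * (Real.pi * I) := by push_cast; ring
  rw [this, Complex.exp_add, Complex.exp_int_mul, Complex.exp_pi_mul_I, mul_comm]
  split_ifs with h
  · rw [h.neg_one_zpow]
  · rw [(Int.not_odd_iff_even.mp h).neg_one_zpow]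

/-! ### Convolutions and sums of sign functions -/

/-- The reindexing of pairs of integers by their sum and first entry. -/
def convolutionEquiv : ℤ × ℤ ≃ ℤ × ℤ where
  toFun p := (p.2, p.1 - p.2)
  invFun p := (p.1 + p.2, p.1)
  left_inv p := by ext <;> simp
  right_inv p := by ext <;> simp

theorem hasSum_convolution {f g c : ℤ → ℂ} {x y : ℂ} (hf : HasSum f x) (hg : HasSum g y)
    (nf : Summable fun n => ‖f n‖) (ng : Summable fun n => ‖g n‖)
    (h : ∀ N : ℤ, HasSum (fun m : ℤ => f m * g (N - m)) (c N)) : HasSum c (x * y) := by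
  have h0 : Summable fun p : ℤ × ℤ => f p.1 * g p.2 := summable_mul_of_summable_norm nf ng
  have h1 : HasSum (fun p : ℤ × ℤ => f p.1 * g p.2) (x * y) := hf.mul hg h0
  exact HasSum.prod_fiberwise (convolutionEquiv.hasSum_iff.mpr h1) h

/-- Multiplication of Fourier series is convolution of coefficients. -/
theorem Rapid.fser_mul {a b c : ℤ → ℂ} (ha : Rapid a) (hb : Rapid b)
    (h : ∀ N : ℤ, HasSum (fun m : ℤ => a m * b (N - m)) (c N)) (u : ℝ) :
    HasSum (fun n : ℤ => c n * cexp (I * n * u)) (fser a u * fser b u) := by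
  refine hasSum_convolution (ha.hasSum_fser u) (hb.hasSum_fser u) ?_ ?_ fun N => ?_
  · refine ha.summable_norm.congr fun n => ?_
    rw [norm_mul, norm_cexp_I_int, mul_one]
  · refine hb.summable_norm.congr fun n => ?_
    rw [norm_mul, norm_cexp_I_int, mul_one]
  refine ((h N).mul_right (cexp (I * N * u))).congr_fun fun m => ?_
  have : cexp (I * N * u) = cexp (I * m * u) * cexp (I * ((N - m : ℤ) : ℂ) * u) := by
    rw [← Complex.exp_add]; congr 1; push_cast; ring
  rw [this]; ring

theorem hasSum_zero_of_odd {f : ℤ → ℂ} (hf : Summable f) (h : ∀ n, f (-n) = -f n) :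
    HasSum f 0 := by
  have h1 := hf.hasSum
  have h2 : HasSum (fun n => f (-n)) (∑' n, f n) := (Equiv.neg ℤ).hasSum_iff.mpr h1
  simp only [h] at h2
  have h3 := h2.unique h1.neg
  have h4 : ∑' n, f n = 0 := self_eq_neg.mp h3
  rwa [h4] at h1

theorem hasSum_zero_of_odd_shift {f : ℤ → ℂ} (hf : Summable f) (h : ∀ n, f (-n) = -f n) (N : ℤ) :
    HasSum (fun n => f (n - N)) 0 :=
  (Equiv.subRight N).hasSum_iff.mpr (hasSum_zero_of_odd hf h)

theorem sign_sub_sign_sub_one (x : ℤ) :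
    (Int.sign x : ℂ) - Int.sign (x - 1) = (Pi.single 0 1 + Pi.single 1 1 : ℤ → ℂ) x := by
  rcases lt_trichotomy x 0 with h | h | h
  · rw [Int.sign_eq_neg_one_of_neg h, Int.sign_eq_neg_one_of_neg (by lia)]
    simp [h.ne, (by lia : x ≠ 1)]
  · subst h; simp
  · rcases eq_or_lt_of_le (show 1 ≤ x from h) with h1 | h1
    · subst h1; simp
    · rw [Int.sign_eq_one_of_pos h, Int.sign_eq_one_of_pos (by lia)]
      simp [h.ne', h1.ne']

/-- Integer induction in both directions from N = 0. The sign sums below are not sums of separately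
summable functions, but their increments in N are finitely supported. -/
theorem hasSum_int_of_diff {f : ℤ → ℤ → ℂ} {c : ℂ} (h0 : ∀ m, f 0 m = 0)
    (h : ∀ N : ℤ, HasSum (fun m => f (N + 1) m - f N m) c) (N : ℤ) :
    HasSum (f N) (c * N) := by
  induction N using Int.induction_on with
  | zero =>
    have : f 0 = fun _ => 0 := funext h0
    simp [this, hasSum_zero]
  | succ n ih =>
    have := ih.add (h n)
    convert this using 1
    · funext m; ring
    · push_cast; ring
  | pred n ih =>
    have := ih.sub (h (-n - 1))
    rw [show c * ((-n - 1 : ℤ) : ℂ) = c * ((-n : ℤ) : ℂ) - c by push_cast; ring]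
    refine this.congr_fun fun m => ?_
    rw [sub_add_cancel]; ring

theorem hasSum_sign_sub (N : ℤ) :
    HasSum (fun m : ℤ => (Int.sign m : ℂ) - Int.sign (m - N)) (2 * N) := by
  refine hasSum_int_of_diff (f := fun N m => (Int.sign m : ℂ) - Int.sign (m - N)) (by simp)
    (fun N => ?_) N
  have h := ((hasSum_pi_single (0 : ℤ) (1 : ℂ)).add (hasSum_pi_single (1 : ℤ) (1 : ℂ)))
  have h2 := (Equiv.subRight N).hasSum_iff.mpr h
  convert h2 using 1
  · funext m
    have := sign_sub_sign_sub_one (m - N)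
    simp only [Function.comp, Equiv.subRight_apply]
    rw [show m - (N + 1) = m - N - 1 by ring]
    simp only [Pi.add_apply] at this
    linear_combination this
  · norm_num

/-- Passing from N to N + 1 changes the summand only at m = N and m = N + 1. Exactly one of these is
odd, so the total grows by 1 instead of the 2 of `hasSum_sign_sub`. -/
theorem hasSum_odd_sign_sub (N : ℤ) :
    HasSum (fun m : ℤ => if Odd m then (Int.sign m : ℂ) - Int.sign (m - N) else 0) N := by
  have key := hasSum_int_of_diff (c := 1)
    (f := fun N m => if Odd m then (Int.sign m : ℂ) - Int.sign (m - N) else 0) (by simp)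
    (fun N => ?_) N
  · simpa using key
  have h : HasSum (Pi.single (if Odd N then N else N + 1) (1 : ℂ)) 1 := hasSum_pi_single _ _
  convert h using 1
  funext m
  have := sign_sub_sign_sub_one (m - N)
  simp only [Pi.add_apply, Pi.single_apply] at this
  by_cases hm : Odd m
  · simp only [hm, if_true]
    have h1 : (m - N = 0 ↔ m = N) := by lia
    have h2 : (m - N = 1 ↔ m = N + 1) := by lia
    rw [show m - (N + 1) = m - N - 1 by ring]
    simp only [h1, h2] at this
    by_cases hN : Odd N
    · have h3 : m ≠ N + 1 := by rintro rfl; exact (Int.not_even_iff_odd.mpr hm) hN.add_one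
      simp only [h3, if_false, hN, if_true, Pi.single_apply] at this ⊢
      linear_combination this
    · have h3 : m ≠ N := by rintro rfl; exact hN hm
      simp only [h3, if_false, hN, Pi.single_apply] at this ⊢
      linear_combination this
  · have h3 : m ≠ (if Odd N then N else N + 1) := by
      rintro rfl
      apply hm
      split_ifs with h
      · exact h
      · exact (Int.not_odd_iff_even.mp h).add_one
    simp [hm, h3]

/-! ### Hyperbolic coefficients: parity, decay and convolution -/

/-- `1 / (2 cosh (n h))` for `q = e^{-h}`. -/
def coshCoeff (q : ℂ) (n : ℤ) : ℂ := q ^ n / (1 + (q ^ n) ^ 2)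

/-- `1 / (2 sinh (n h))` for `q = e^{-h}`, and `0` for `n = 0`. -/
def sinhCoeff (q : ℂ) (n : ℤ) : ℂ := q ^ n / (1 - (q ^ n) ^ 2)

/-- `tanh (n h)` for `q = e^{-h}`. -/
def tanhCoeff (q : ℂ) (n : ℤ) : ℂ := (1 - (q ^ n) ^ 2) / (1 + (q ^ n) ^ 2)

/-- `coth (n h)` for `q = e^{-h}`, and `0` for `n = 0`. -/
def cothCoeff (q : ℂ) (n : ℤ) : ℂ := (1 + (q ^ n) ^ 2) / (1 - (q ^ n) ^ 2)

/-- The coefficients `1 / (2 sinh (n h))` for odd `n`. -/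
def oddSinhCoeff (q : ℂ) (n : ℤ) : ℂ := if Odd n then sinhCoeff q n else 0

variable {q : ℂ}

theorem zpow_sq_ne_one (hq : ‖q‖ < 1) {n : ℤ} (hn : n ≠ 0) : ‖(q ^ n) ^ 2‖ ≠ 1 := by
  intro h
  rw [norm_pow, norm_zpow] at h
  have h1 : ‖q‖ ^ n = 1 := by
    have := zpow_nonneg (norm_nonneg q) n
    nlinarith
  exact hn ((zpow_eq_one_iff_right₀ (norm_nonneg q) hq.ne).mp h1)

theorem one_sub_zpow_ne (hq : ‖q‖ < 1) {n : ℤ} (hn : n ≠ 0) :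
    1 - (q ^ n) ^ 2 ≠ 0 := by
  intro h
  apply zpow_sq_ne_one hq hn
  rw [← sub_eq_zero.mp h, norm_one]

theorem one_add_zpow_ne (hq : ‖q‖ < 1) (n : ℤ) : 1 + (q ^ n) ^ 2 ≠ 0 := by
  intro h
  rcases eq_or_ne n 0 with rfl | hn
  · norm_num at h
  apply zpow_sq_ne_one hq hn
  rw [← neg_eq_of_add_eq_zero_right h, norm_neg, norm_one]

theorem coshCoeff_neg (hq0 : q ≠ 0) (n : ℤ) : coshCoeff q (-n) = coshCoeff q n := by
  have h := zpow_ne_zero n hq0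
  rw [coshCoeff, coshCoeff, zpow_neg]
  generalize q ^ n = x at *
  -- If the denominator vanishes, both sides are 0 by the convention x / 0 = 0.
  by_cases hx : 1 + x ^ 2 = 0
  · rw [hx, show (1 : ℂ) + x⁻¹ ^ 2 = (1 + x ^ 2) / x ^ 2 by field_simp; ring, hx]; simp
  · rw [show (1 : ℂ) + x⁻¹ ^ 2 = (1 + x ^ 2) / x ^ 2 by field_simp; ring]
    field_simp

theorem sinhCoeff_neg (hq0 : q ≠ 0) (n : ℤ) : sinhCoeff q (-n) = -sinhCoeff q n := by
  have h := zpow_ne_zero n hq0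
  rw [sinhCoeff, sinhCoeff, zpow_neg]
  generalize q ^ n = x at *
  rw [show (1 : ℂ) - x⁻¹ ^ 2 = -(1 - x ^ 2) / x ^ 2 by field_simp; ring]
  by_cases hx : 1 - x ^ 2 = 0
  · simp [hx]
  · field_simp

theorem tanhCoeff_neg (hq0 : q ≠ 0) (n : ℤ) : tanhCoeff q (-n) = -tanhCoeff q n := by
  have h := zpow_ne_zero n hq0
  rw [tanhCoeff, tanhCoeff, zpow_neg]
  generalize q ^ n = x at *
  rw [show (1 : ℂ) - x⁻¹ ^ 2 = -(1 - x ^ 2) / x ^ 2 by field_simp; ring,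
    show (1 : ℂ) + x⁻¹ ^ 2 = (1 + x ^ 2) / x ^ 2 by field_simp; ring]
  by_cases hx : 1 + x ^ 2 = 0
  · simp [hx]
  · field_simp

theorem cothCoeff_neg (hq0 : q ≠ 0) (n : ℤ) : cothCoeff q (-n) = -cothCoeff q n := by
  have h := zpow_ne_zero n hq0
  rw [cothCoeff, cothCoeff, zpow_neg]
  generalize q ^ n = x at *
  rw [show (1 : ℂ) - x⁻¹ ^ 2 = -(1 - x ^ 2) / x ^ 2 by field_simp; ring,
    show (1 : ℂ) + x⁻¹ ^ 2 = (1 + x ^ 2) / x ^ 2 by field_simp; ring]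
  by_cases hx : 1 - x ^ 2 = 0
  · simp [hx]
  · field_simp

theorem oddSinhCoeff_neg (hq0 : q ≠ 0) (n : ℤ) : oddSinhCoeff q (-n) = -oddSinhCoeff q n := by
  simp only [oddSinhCoeff, odd_neg, sinhCoeff_neg hq0]
  split_ifs <;> simp

theorem norm_coshCoeff_le (hq0 : q ≠ 0) (hq : ‖q‖ < 1) (n : ℤ) :
    ‖coshCoeff q n‖ ≤ (1 - ‖q‖)⁻¹ * ‖q‖ ^ n.natAbs := by
  have h1 : 0 < 1 - ‖q‖ := by linarith
  have key : ∀ m : ℕ, ‖coshCoeff q m‖ ≤ (1 - ‖q‖)⁻¹ * ‖q‖ ^ m := by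
    intro m
    rw [coshCoeff, zpow_natCast, norm_div, norm_pow, div_eq_mul_inv, mul_comm]
    refine mul_le_mul_of_nonneg_right (inv_anti₀ h1 ?_) (by positivity)
    rcases Nat.eq_zero_or_pos m with rfl | hm
    · simp; norm_num; linarith [norm_nonneg q]
    have h2 : ‖(q ^ m) ^ 2‖ ≤ ‖q‖ := by
      rw [← pow_mul, norm_pow]
      calc ‖q‖ ^ (m * 2) ≤ ‖q‖ ^ 1 := pow_le_pow_of_le_one (norm_nonneg _) hq.le (by lia)
        _ = ‖q‖ := pow_one _
    have h3 := norm_sub_norm_le (1 : ℂ) (-(q ^ m) ^ 2)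
    rw [norm_neg, norm_one, sub_neg_eq_add] at h3
    linarith
  obtain ⟨m, rfl | rfl⟩ := n.eq_nat_or_neg
  · simpa using key m
  · rw [coshCoeff_neg hq0]; simpa using key m

theorem norm_sinhCoeff_le (hq0 : q ≠ 0) (hq : ‖q‖ < 1) (n : ℤ) :
    ‖sinhCoeff q n‖ ≤ (1 - ‖q‖)⁻¹ * ‖q‖ ^ n.natAbs := by
  have h1 : 0 < 1 - ‖q‖ := by linarith
  have key : ∀ m : ℕ, ‖sinhCoeff q m‖ ≤ (1 - ‖q‖)⁻¹ * ‖q‖ ^ m := by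
    intro m
    rcases Nat.eq_zero_or_pos m with rfl | hm
    · simp [sinhCoeff]; linarith
    rw [sinhCoeff, zpow_natCast, norm_div, norm_pow, div_eq_mul_inv, mul_comm]
    refine mul_le_mul_of_nonneg_right (inv_anti₀ h1 ?_) (by positivity)
    have h2 : ‖(q ^ m) ^ 2‖ ≤ ‖q‖ := by
      rw [← pow_mul, norm_pow]
      calc ‖q‖ ^ (m * 2) ≤ ‖q‖ ^ 1 := pow_le_pow_of_le_one (norm_nonneg _) hq.le (by lia)
        _ = ‖q‖ := pow_one _
    have h3 := norm_sub_norm_le (1 : ℂ) ((q ^ m) ^ 2)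
    rw [norm_one] at h3
    linarith
  obtain ⟨m, rfl | rfl⟩ := n.eq_nat_or_neg
  · simpa using key m
  · rw [sinhCoeff_neg hq0, norm_neg]; simpa using key m

theorem rapid_coshCoeff (hq0 : q ≠ 0) (hq : ‖q‖ < 1) : Rapid (coshCoeff q) :=
  rapid_of_geometric (norm_nonneg q) hq (norm_coshCoeff_le hq0 hq)

theorem rapid_sinhCoeff (hq0 : q ≠ 0) (hq : ‖q‖ < 1) : Rapid (sinhCoeff q) :=
  rapid_of_geometric (norm_nonneg q) hq (norm_sinhCoeff_le hq0 hq)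

theorem Rapid.ite {a : ℤ → ℂ} (ha : Rapid a) (p : ℤ → Prop) [DecidablePred p] :
    Rapid fun n => if p n then a n else 0 :=
  ha.of_norm_le fun n => by split_ifs <;> simp

theorem rapid_oddSinhCoeff (hq0 : q ≠ 0) (hq : ‖q‖ < 1) : Rapid (oddSinhCoeff q) :=
  (rapid_sinhCoeff hq0 hq).ite _

theorem norm_tanhCoeff_sub_sign_le (hq0 : q ≠ 0) (hq : ‖q‖ < 1) (n : ℤ) :
    ‖tanhCoeff q n - Int.sign n‖ ≤ ‖2 * coshCoeff q n‖ := by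
  have key : ∀ m : ℕ, ‖tanhCoeff q m - Int.sign m‖ ≤ ‖2 * coshCoeff q m‖ := by
    intro m
    rcases Nat.eq_zero_or_pos m with rfl | hm
    · simp [tanhCoeff]
    have h0 := one_add_zpow_ne hq (m : ℤ)
    have h1 : tanhCoeff q m - Int.sign m = -(2 * coshCoeff q m) * q ^ m := by
      rw [Int.sign_eq_one_of_pos (by exact_mod_cast hm), tanhCoeff, coshCoeff]
      rw [zpow_natCast] at *
      push_cast
      field_simp
      ring
    rw [h1, norm_mul, norm_neg, norm_pow]
    exact mul_le_of_le_one_right (norm_nonneg _) (pow_le_one₀ (norm_nonneg _) hq.le)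
  obtain ⟨m, rfl | rfl⟩ := n.eq_nat_or_neg
  · exact key m
  · rw [coshCoeff_neg hq0, tanhCoeff_neg hq0, Int.sign_neg, Int.cast_neg, ← neg_sub', norm_neg]
    exact key m

theorem norm_cothCoeff_sub_sign_le (hq0 : q ≠ 0) (hq : ‖q‖ < 1) (n : ℤ) :
    ‖cothCoeff q n - Int.sign n‖ ≤ ‖2 * sinhCoeff q n‖ := by
  have key : ∀ m : ℕ, ‖cothCoeff q m - Int.sign m‖ ≤ ‖2 * sinhCoeff q m‖ := by
    intro m
    rcases Nat.eq_zero_or_pos m with rfl | hm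
    · simp [cothCoeff]
    have h0 := one_sub_zpow_ne hq (n := (m : ℤ)) (by exact_mod_cast hm.ne')
    have h1 : cothCoeff q m - Int.sign m = 2 * sinhCoeff q m * q ^ m := by
      rw [Int.sign_eq_one_of_pos (by exact_mod_cast hm), cothCoeff, sinhCoeff]
      rw [zpow_natCast] at *
      push_cast
      field_simp
      ring
    rw [h1, norm_mul, norm_pow]
    exact mul_le_of_le_one_right (norm_nonneg _) (pow_le_one₀ (norm_nonneg _) hq.le)
  obtain ⟨m, rfl | rfl⟩ := n.eq_nat_or_neg
  · exact key m
  · rw [sinhCoeff_neg hq0, cothCoeff_neg hq0, Int.sign_neg, Int.cast_neg, ← neg_sub', norm_neg,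
      mul_neg, norm_neg (2 * _)]
    exact key m

theorem rapid_tanhCoeff_sub_sign (hq0 : q ≠ 0) (hq : ‖q‖ < 1) :
    Rapid fun n => tanhCoeff q n - Int.sign n :=
  ((rapid_coshCoeff hq0 hq).const_mul 2).of_norm_le (norm_tanhCoeff_sub_sign_le hq0 hq)

theorem rapid_cothCoeff_sub_sign (hq0 : q ≠ 0) (hq : ‖q‖ < 1) :
    Rapid fun n => cothCoeff q n - Int.sign n :=
  ((rapid_sinhCoeff hq0 hq).const_mul 2).of_norm_le (norm_cothCoeff_sub_sign_le hq0 hq)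

/-- The addition formula tanh x - tanh y = sinh(x - y) / (cosh x cosh y), read as a partial fraction
decomposition in m. It makes the convolution telescope. -/
theorem coshCoeff_mul (hq0 : q ≠ 0) (hq : ‖q‖ < 1) (m : ℤ) {N : ℤ} (hN : N ≠ 0) :
    coshCoeff q m * coshCoeff q (N - m) =
      sinhCoeff q N / 2 * (tanhCoeff q m - tanhCoeff q (m - N)) := by
  have h1 := one_sub_zpow_ne hq hN
  have h2 := one_add_zpow_ne hq m
  have h3 := one_add_zpow_ne hq (N - m)
  rw [show m - N = -(N - m) by ring, tanhCoeff_neg hq0]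
  simp only [coshCoeff, sinhCoeff, tanhCoeff]
  have e : q ^ N = q ^ m * q ^ (N - m) := by rw [← zpow_add₀ hq0]; congr 1; ring
  simp only [e, mul_pow] at h1 ⊢
  clear e
  generalize q ^ m = x at *
  generalize q ^ (N - m) = y at *
  field_simp
  ring

/-- The companion formula coth x - tanh y = cosh(x - y) / (sinh x cosh y). -/
theorem sinhCoeff_mul_coshCoeff (hq0 : q ≠ 0) (hq : ‖q‖ < 1) {m : ℤ} (hm : m ≠ 0) (N : ℤ) :
    sinhCoeff q m * coshCoeff q (N - m) =
      coshCoeff q N / 2 * (cothCoeff q m - tanhCoeff q (m - N)) := by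
  have h1 := one_add_zpow_ne hq N
  have h2 := one_sub_zpow_ne hq hm
  have h3 := one_add_zpow_ne hq (N - m)
  rw [show m - N = -(N - m) by ring, tanhCoeff_neg hq0]
  simp only [coshCoeff, sinhCoeff, tanhCoeff, cothCoeff]
  have e : q ^ N = q ^ m * q ^ (N - m) := by rw [← zpow_add₀ hq0]; congr 1; ring
  simp only [e, mul_pow] at h1 ⊢
  clear e
  generalize q ^ m = x at *
  generalize q ^ (N - m) = y at *
  field_simp
  ring

/-- Write tanh as sign plus a rapidly decaying odd remainder. The remainder and its translate each
sum to 0, so only the sum of sign differences, 2N, survives. -/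
theorem hasSum_coshCoeff_mul (hq0 : q ≠ 0) (hq : ‖q‖ < 1) {N : ℤ} (hN : N ≠ 0) :
    HasSum (fun m => coshCoeff q m * coshCoeff q (N - m)) (N * sinhCoeff q N) := by
  have hs := (rapid_tanhCoeff_sub_sign hq0 hq).summable
  have ho : ∀ n : ℤ, tanhCoeff q (-n) - (Int.sign (-n) : ℂ) = -(tanhCoeff q n - Int.sign n) := by
    intro n; rw [tanhCoeff_neg hq0, Int.sign_neg]; push_cast; ring
  have h1 := hasSum_zero_of_odd hs ho
  have h2 := hasSum_zero_of_odd_shift hs ho N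
  have h3 := ((h1.sub h2).add (hasSum_sign_sub N)).mul_left (sinhCoeff q N / 2)
  rw [show N * sinhCoeff q N = sinhCoeff q N / 2 * (0 - 0 + 2 * N) by ring]
  refine h3.congr_fun fun m => ?_
  rw [coshCoeff_mul hq0 hq m hN]
  ring

theorem hasSum_oddSinhCoeff_mul (hq0 : q ≠ 0) (hq : ‖q‖ < 1) (N : ℤ) :
    HasSum (fun m => oddSinhCoeff q m * coshCoeff q (N - m)) (1 / 2 * (N * coshCoeff q N)) := by
  have hs1 := ((rapid_cothCoeff_sub_sign hq0 hq).ite (fun n => Odd n)).summable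
  have hs2 := ((rapid_tanhCoeff_sub_sign hq0 hq).ite (fun n => Odd (n + N))).summable
  have h1 := hasSum_zero_of_odd hs1 (fun n => by
    simp only [odd_neg, cothCoeff_neg hq0, Int.sign_neg]
    split_ifs <;> push_cast <;> ring)
  have h2 := hasSum_zero_of_odd_shift hs2 (fun n => by
    have : Odd (-n + N) ↔ Odd (n + N) := by
      simp only [← Int.not_even_iff_odd, Int.even_add, even_neg]
    simp only [this, tanhCoeff_neg hq0, Int.sign_neg]
    split_ifs <;> push_cast <;> ring) N
  have h3 := ((h1.sub h2).add (hasSum_odd_sign_sub N)).mul_left (coshCoeff q N / 2)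
  rw [show 1 / 2 * (N * coshCoeff q N) = coshCoeff q N / 2 * (0 - 0 + N) by ring]
  refine h3.congr_fun fun m => ?_
  rw [sub_add_cancel, oddSinhCoeff]
  by_cases hm : Odd m
  · simp only [hm, if_true]
    rw [sinhCoeff_mul_coshCoeff hq0 hq (by rintro rfl; simp at hm) N]
    ring
  · simp [hm]

/-! ### Jacobi functions as Fourier series -/

/-- `∑_n e^{inu} / (2 cosh (n h))`, which is `C + D` in terms of Jacobi's `cn` and `dn`. -/
def jacW (q : ℂ) (u : ℝ) : ℂ := fser (coshCoeff q) u

/-- `∑_{n odd} e^{inu} / (2 sinh (n h))`, essentially Jacobi's `sn`. -/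
def jacS (q : ℂ) (u : ℝ) : ℂ := fser (oddSinhCoeff q) u

theorem jacS_mul_jacW (hq0 : q ≠ 0) (hq : ‖q‖ < 1) (u : ℝ) :
    jacS q u * jacW q u = 1 / 2 * fser (fun n => n * coshCoeff q n) u := by
  rw [← fser_const_mul]
  exact ((rapid_oddSinhCoeff hq0 hq).fser_mul (rapid_coshCoeff hq0 hq)
    (hasSum_oddSinhCoeff_mul hq0 hq) u).tsum_eq.symm

/-- The coefficient of frequency 0 escapes the partial fraction formula. Its value r can stay
unspecified: it cancels from the odd-frequency part, and `lameOp` annihilates it in the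
even-frequency part. -/
theorem exists_jacW_sq (hq0 : q ≠ 0) (hq : ‖q‖ < 1) :
    ∃ r : ℂ, ∀ u, jacW q u ^ 2 = r + fser (fun n => n * sinhCoeff q n) u := by
  set r := ∑' m, coshCoeff q m * coshCoeff q (0 - m) with hr
  have hc := rapid_coshCoeff hq0 hq
  have hrs : HasSum (fun m => coshCoeff q m * coshCoeff q (0 - m)) r := by
    refine Summable.hasSum (Summable.of_norm ?_)
    have h1 := hc.summable_norm.mul_left (1 - ‖q‖)⁻¹
    refine h1.of_nonneg_of_le (fun _ => norm_nonneg _) fun m => ?_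
    rw [norm_mul, zero_sub, coshCoeff_neg hq0]
    refine mul_le_mul_of_nonneg_right ((norm_coshCoeff_le hq0 hq m).trans ?_) (norm_nonneg _)
    have : 0 < 1 - ‖q‖ := by linarith
    exact mul_le_of_le_one_right (by positivity) (pow_le_one₀ (norm_nonneg _) hq.le)
  refine ⟨r, fun u => ?_⟩
  have h := hc.fser_mul hc (c := fun N => if N = 0 then r else N * sinhCoeff q N) (fun N => by
    split_ifs with hN
    · rw [hN]; exact hrs
    · exact hasSum_coshCoeff_mul hq0 hq hN) u
  -- The term of index 0 in the first series vanishes, so the point mass supplies exactly the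
  -- missing constant.
  have h2 := ((rapid_sinhCoeff hq0 hq).int_mul.hasSum_fser u).add (hasSum_pi_single (0 : ℤ) r)
  rw [sq, add_comm]
  refine h.unique (h2.congr_fun fun n => ?_)
  by_cases hn : n = 0
  · simp [hn]
  · simp [hn]

/-! ### Differential equations, first integrals and moments -/

section Jacobi

variable {q : ℂ}

theorem fser_add_pi (a : ℤ → ℂ) (u : ℝ) :
    fser a (u + Real.pi) = ∑' n : ℤ, (if Odd n then -1 else 1) * (a n * cexp (I * n * u)) := by
  rw [fser]
  refine tsum_congr fun n => ?_
  rw [cexp_I_int_add_pi]; ring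

theorem Rapid.fser_sub_fser_add_pi {a : ℤ → ℂ} (ha : Rapid a) (u : ℝ) :
    fser a u - fser a (u + Real.pi) = 2 * fser (fun n => if Odd n then a n else 0) u := by
  have h1 := ha.hasSum_fser u
  have h2 := ha.hasSum_fser (u + Real.pi)
  have h3 := ((ha.ite fun n => Odd n).hasSum_fser u).mul_left 2
  refine (h1.sub h2).unique (h3.congr_fun fun n => ?_)
  rw [cexp_I_int_add_pi]
  split_ifs <;> ring

theorem Rapid.fser_add_fser_add_pi {a : ℤ → ℂ} (ha : Rapid a) (u : ℝ) :
    fser a u + fser a (u + Real.pi) = 2 * fser (fun n => if Even n then a n else 0) u := by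
  have h1 := ha.hasSum_fser u
  have h2 := ha.hasSum_fser (u + Real.pi)
  have h3 := ((ha.ite fun n => Even n).hasSum_fser u).mul_left 2
  refine (h1.add h2).unique (h3.congr_fun fun n => ?_)
  rw [cexp_I_int_add_pi]
  by_cases h : Odd n
  · simp [h, Int.not_even_iff_odd.mpr h]
  · simp [h, Int.not_odd_iff_even.mp h]; ring

theorem jacS_add_pi (u : ℝ) : jacS q (u + Real.pi) = -jacS q u := by
  rw [jacS, fser_add_pi, jacS, fser, ← tsum_neg]
  refine tsum_congr fun n => ?_
  by_cases h : Odd n <;> simp [oddSinhCoeff, h]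

theorem jacS_zero (hq0 : q ≠ 0) (hq : ‖q‖ < 1) : jacS q 0 = 0 := by
  rw [jacS, fser_zero]
  exact (hasSum_zero_of_odd (rapid_oddSinhCoeff hq0 hq).summable (oddSinhCoeff_neg hq0)).tsum_eq

theorem hasDerivAt_jacW (hq0 : q ≠ 0) (hq : ‖q‖ < 1) (u : ℝ) :
    HasDerivAt (jacW q) (2 * I * jacS q u * jacW q u) u := by
  refine ((rapid_coshCoeff hq0 hq).hasDerivAt_fser u).congr_deriv ?_
  linear_combination -2 * I * jacS_mul_jacW hq0 hq u

theorem hasDerivAt_jacW_add_pi (hq0 : q ≠ 0) (hq : ‖q‖ < 1) (u : ℝ) :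
    HasDerivAt (fun u => jacW q (u + Real.pi)) (-(2 * I * jacS q u * jacW q (u + Real.pi))) u := by
  refine ((hasDerivAt_jacW hq0 hq (u + Real.pi)).comp_add_const u Real.pi).congr_deriv ?_
  rw [jacS_add_pi]; ring

/-- Subtracting the translate by π isolates the odd frequencies of W², and the constant r cancels.
-/
theorem fser_int_mul_oddSinhCoeff (hq0 : q ≠ 0) (hq : ‖q‖ < 1) (u : ℝ) :
    fser (fun n => n * oddSinhCoeff q n) u = 1 / 2 * (jacW q u ^ 2 - jacW q (u + Real.pi) ^ 2) := by
  obtain ⟨r, hr⟩ := exists_jacW_sq hq0 hq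
  have h := (rapid_sinhCoeff hq0 hq).int_mul.fser_sub_fser_add_pi u
  have e : (fun n : ℤ => (n : ℂ) * oddSinhCoeff q n) =
      fun n => if Odd n then n * sinhCoeff q n else 0 := by
    funext n; simp [oddSinhCoeff]
  rw [e, hr, hr]
  linear_combination -1 / 2 * h

theorem hasDerivAt_jacS (hq0 : q ≠ 0) (hq : ‖q‖ < 1) (u : ℝ) :
    HasDerivAt (jacS q) (I / 2 * (jacW q u ^ 2 - jacW q (u + Real.pi) ^ 2)) u := by
  refine ((rapid_oddSinhCoeff hq0 hq).hasDerivAt_fser u).congr_deriv ?_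
  rw [fser_int_mul_oddSinhCoeff hq0 hq]; ring

theorem eq_of_hasDerivAt_zero {f : ℝ → ℂ} (h : ∀ u, HasDerivAt f 0 u) (u v : ℝ) : f u = f v :=
  is_const_of_deriv_eq_zero (fun u => (h u).differentiableAt) (fun u => (h u).deriv) u v

/-- Since S changes sign under u ↦ u + π, the logarithmic derivatives of the two factors are
opposite. In Jacobi's notation this is the relation between dn² and cn². -/
theorem jacW_mul_jacW_add_pi (hq0 : q ≠ 0) (hq : ‖q‖ < 1) (u : ℝ) :
    jacW q u * jacW q (u + Real.pi) = jacW q 0 * jacW q Real.pi := by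
  have := eq_of_hasDerivAt_zero (f := fun u => jacW q u * jacW q (u + Real.pi)) (fun u =>
    ((hasDerivAt_jacW hq0 hq u).mul (hasDerivAt_jacW_add_pi hq0 hq u)).congr_deriv (by ring)) u 0
  simpa using this

theorem jacW_sq_add (hq0 : q ≠ 0) (hq : ‖q‖ < 1) (u : ℝ) :
    jacW q u ^ 2 + jacW q (u + Real.pi) ^ 2 =
      4 * jacS q u ^ 2 + (jacW q 0 ^ 2 + jacW q Real.pi ^ 2) := by
  have := eq_of_hasDerivAt_zero
    (f := fun u => jacW q u ^ 2 + jacW q (u + Real.pi) ^ 2 - 4 * jacS q u ^ 2) (fun u =>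
    (((hasDerivAt_jacW hq0 hq u).pow 2).add ((hasDerivAt_jacW_add_pi hq0 hq u).pow 2)).sub
      (((hasDerivAt_jacS hq0 hq u).pow 2).const_mul 4) |>.congr_deriv (by
        norm_num; ring)) u 0
  simp only [zero_add, jacS_zero hq0 hq] at this
  linear_combination this

/-- `cn dn` at the origin, in the normalization of `jacW`. It equals `η(4τ)⁸ / η(2τ)⁴`. -/
def formF (q : ℂ) : ℂ := (jacW q 0 ^ 2 - jacW q Real.pi ^ 2) / 4

/-- The fourth power of the theta constant `θ₃`. -/
def formT (q : ℂ) : ℂ := 4 * jacW q 0 ^ 2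

open Polynomial in
/-- The operator on polynomials in `s` induced by `d²/du²` when
`(ds/du)² = 4 (s⁴ + σ s² + ρ²)`. -/
def lameOp (σ ρ : ℂ) (Q : ℂ[X]) : ℂ[X] :=
  derivative (derivative Q) * (C 4 * (X ^ 4 + C σ * X ^ 2 + C (ρ ^ 2))) +
    derivative Q * (C 4 * (2 * X ^ 3 + C σ * X))

theorem fser_int_mul_of_eq_eval (hq0 : q ≠ 0) (hq : ‖q‖ < 1) {a : ℤ → ℂ} (ha : Rapid a)
    {Q : Polynomial ℂ} (h : ∀ u, fser a u = Q.eval (jacS q u)) (u : ℝ) :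
    fser (fun n => n * a n) u =
      Q.derivative.eval (jacS q u) * (1 / 2 * (jacW q u ^ 2 - jacW q (u + Real.pi) ^ 2)) := by
  have h1 := ha.hasDerivAt_fser u
  have h2 := (Q.hasDerivAt (jacS q u)).scomp u (hasDerivAt_jacS hq0 hq u)
  have h3 : fser a = (fun x => Q.eval x) ∘ jacS q := funext h
  rw [← h3] at h2
  have h4 := h1.unique h2
  rw [smul_eq_mul] at h4
  refine mul_left_cancel₀ I_ne_zero ?_
  rw [h4]; ring

/-- Multiplying coefficients by n² is -d²/du². The two first integrals give (S')² = -4(S⁴ + σS² +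
F²) with σ = (W(0)² + W(π)²)/2 = T/4 - 2F, so the minus signs cancel and `lameOp` appears. -/
theorem fser_int_sq_mul_of_eq_eval (hq0 : q ≠ 0) (hq : ‖q‖ < 1) {a : ℤ → ℂ} (ha : Rapid a)
    {Q : Polynomial ℂ} (h : ∀ u, fser a u = Q.eval (jacS q u)) (u : ℝ) :
    fser (fun n => n * (n * a n)) u =
      (lameOp (formT q / 4 - 2 * formF q) (formF q) Q).eval (jacS q u) := by
  have h1 := ha.int_mul.hasDerivAt_fser u
  have h2 := (Q.derivative.hasDerivAt (jacS q u)).scomp u (hasDerivAt_jacS hq0 hq u)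
  have h3 := (((hasDerivAt_jacW hq0 hq u).pow 2).sub
    ((hasDerivAt_jacW_add_pi hq0 hq u).pow 2)).const_mul (1 / 2 : ℂ)
  have h4 : fser (fun n => n * a n) = ((fun x => Q.derivative.eval x) ∘ jacS q) *
      (fun u => 1 / 2 * (jacW q u ^ 2 - jacW q (u + Real.pi) ^ 2)) :=
    funext (fser_int_mul_of_eq_eval hq0 hq ha h)
  have h5 := h2.mul h3
  rw [h4] at h1
  have h6 := h1.unique h5
  simp only [smul_eq_mul, Function.comp, Pi.sub_apply, Pi.pow_apply] at h6
  have e1 := jacW_sq_add hq0 hq u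
  have e2 := jacW_mul_jacW_add_pi hq0 hq u
  refine mul_left_cancel₀ I_ne_zero ?_
  rw [h6]
  simp only [lameOp, Polynomial.eval_add, Polynomial.eval_mul, Polynomial.eval_pow,
    Polynomial.eval_X, Polynomial.eval_C, Polynomial.eval_ofNat, formT, formF]
  generalize jacW q u = w at *
  generalize jacW q (u + Real.pi) = v at *
  generalize jacS q u = s at *
  generalize jacW q 0 = w0 at *
  generalize jacW q Real.pi = v0 at *
  generalize Polynomial.eval s Q.derivative = Q1
  generalize Polynomial.eval s (Polynomial.derivative Q.derivative) = Q2
  have e3 : (w ^ 2 - v ^ 2) ^ 2 = (4 * s ^ 2 + (w0 ^ 2 + v0 ^ 2)) ^ 2 - 4 * (w0 * v0) ^ 2 := by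
    rw [← e1, ← e2]; ring
  norm_num
  linear_combination I / 4 * Q2 * e3 + 2 * I * s * Q1 * e1

theorem fser_pow_mul_of_eq_eval (hq0 : q ≠ 0) (hq : ‖q‖ < 1) {a : ℤ → ℂ} (ha : Rapid a)
    {Q : Polynomial ℂ} (h : ∀ u, fser a u = Q.eval (jacS q u)) (j : ℕ) :
    Rapid (fun n => n ^ (2 * j) * a n) ∧ ∀ u, fser (fun n => n ^ (2 * j) * a n) u =
      ((lameOp (formT q / 4 - 2 * formF q) (formF q))^[j] Q).eval (jacS q u) := by
  induction j with
  | zero => simpa using ⟨ha, h⟩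
  | succ j ih =>
    have e : (fun n : ℤ => (n : ℂ) ^ (2 * (j + 1)) * a n) =
      fun n : ℤ => (n : ℂ) * (n * ((n : ℂ) ^ (2 * j) * a n)) := by funext n; ring
    rw [e, Function.iterate_succ_apply']
    exact ⟨ih.1.int_mul.int_mul, fser_int_sq_mul_of_eq_eval hq0 hq ih.1 ih.2⟩

/-- The odd moments of the odd coefficients. -/
theorem tsum_oddSinhCoeff (hq0 : q ≠ 0) (hq : ‖q‖ < 1) (j : ℕ) :
    ∑' n : ℤ, (n : ℂ) ^ (2 * j + 1) * oddSinhCoeff q n = 2 * formF q *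
      ((lameOp (formT q / 4 - 2 * formF q) (formF q))^[j] Polynomial.X).coeff 1 := by
  obtain ⟨h1, h2⟩ := fser_pow_mul_of_eq_eval hq0 hq (rapid_oddSinhCoeff hq0 hq)
    (Q := Polynomial.X) (fun u => by rw [Polynomial.eval_X]; rfl) j
  have h3 := fser_int_mul_of_eq_eval hq0 hq h1 h2 0
  rw [fser_zero, jacS_zero hq0 hq, zero_add, ← Polynomial.coeff_zero_eq_eval_zero,
    Polynomial.coeff_derivative] at h3
  rw [← tsum_congr fun n => ?_, h3]
  · rw [formF]; push_cast; ring
  · ring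

theorem lameOp_sub_C (σ ρ c : ℂ) (Q : Polynomial ℂ) :
    lameOp σ ρ (Q - Polynomial.C c) = lameOp σ ρ Q := by
  simp [lameOp]

/-- The odd moments of the even coefficients. -/
theorem tsum_evenSinhCoeff (hq0 : q ≠ 0) (hq : ‖q‖ < 1) (j : ℕ) :
    ∑' n : ℤ, (n : ℂ) ^ (2 * j + 3) * (if Even n then sinhCoeff q n else 0) = 2 *
      ((lameOp (formT q / 4 - 2 * formF q) (formF q))^[j + 1] (Polynomial.X ^ 2)).coeff 0 := by
  obtain ⟨r, hr⟩ := exists_jacW_sq hq0 hq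
  -- With the factor 1/2 the series is S² up to a constant, by the second first integral; one of the
  -- 2j + 3 powers of n is already absorbed here.
  set a : ℤ → ℂ := fun n => 1 / 2 * (if Even n then n * sinhCoeff q n else 0) with ha
  have hR := (rapid_sinhCoeff hq0 hq).int_mul
  have hRa : Rapid a := (hR.ite fun n => Even n).const_mul _
  set c : ℂ := r / 2 - (jacW q 0 ^ 2 + jacW q Real.pi ^ 2) / 4 with hc
  have h0 : ∀ u, fser a u = (Polynomial.X ^ 2 - Polynomial.C c : Polynomial ℂ).eval (jacS q u) := by
    intro u
    rw [ha, fser_const_mul]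
    have h1 := hR.fser_add_fser_add_pi u
    have h2 := jacW_sq_add hq0 hq u
    have h3 := hr u
    have h4 := hr (u + Real.pi)
    simp only [Polynomial.eval_sub, Polynomial.eval_pow, Polynomial.eval_X, Polynomial.eval_C, hc]
    linear_combination -1 / 4 * h1 + 1 / 4 * h2 - 1 / 4 * h3 - 1 / 4 * h4
  obtain ⟨-, h2⟩ := fser_pow_mul_of_eq_eval hq0 hq hRa h0 (j + 1)
  have h3 := h2 0
  -- One application of `lameOp` removes the constant c, and with it the unknown r.
  rw [fser_zero, jacS_zero hq0 hq, ← Polynomial.coeff_zero_eq_eval_zero,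
    Function.iterate_succ_apply, lameOp_sub_C, ← Function.iterate_succ_apply] at h3
  rw [← h3, ← tsum_mul_left]
  refine tsum_congr fun n => ?_
  rw [ha]
  by_cases hn : Even n <;> simp [hn]; ring

end Jacobi

/-! ### Homogeneity of the iterates of `lameOp` -/

section WeightedForms
open Polynomial

/-- Polynomials in `s`, `ρ`, `T` with rational coefficients, homogeneous of weight `w` when
`s` has weight one and `ρ`, `T` have weight two. -/
inductive WForm : ℕ → (ℂ → ℂ → ℂ[X]) → Prop
  | monomial {w : ℕ} (n i l : ℕ) (c : ℚ) (h : n + 2 * i + 2 * l = w) :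
      WForm w fun ρ T => C ((c : ℂ) * ρ ^ i * T ^ l) * X ^ n
  | add {w : ℕ} {P Q : ℂ → ℂ → ℂ[X]} : WForm w P → WForm w Q → WForm w fun ρ T => P ρ T + Q ρ T

theorem WForm.zero (w : ℕ) (h : Even w) : WForm w fun _ _ => 0 := by
  obtain ⟨r, rfl⟩ := h
  have := WForm.monomial (w := r + r) 0 r 0 0 (by ring)
  convert this using 3
  simp

theorem derivative_C_mul_X_pow_add_two (c : ℂ) (m : ℕ) :
    derivative (C c * X ^ (m + 2)) = C (c * (m + 2)) * X ^ (m + 1) := by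
  rw [derivative_C_mul_X_pow]; push_cast; congr 1

theorem lameOp_monomial_add_two (σ ρ c : ℂ) (m : ℕ) :
    lameOp σ ρ (C c * X ^ (m + 2)) = C (4 * c * (m + 2) * (m + 3)) * X ^ (m + 4) +
      C (4 * c * (m + 2) ^ 2 * σ) * X ^ (m + 2) +
        C (4 * c * (m + 2) * (m + 1) * ρ ^ 2) * X ^ m := by
  rw [lameOp, derivative_C_mul_X_pow_add_two, derivative_C_mul_X_pow]
  simp only [Nat.add_sub_cancel, C_mul, C_add, C_pow, Nat.cast_add, Nat.cast_one, map_one]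
  simp only [map_ofNat]
  ring

theorem lameOp_monomial_one (σ ρ c : ℂ) :
    lameOp σ ρ (C c * X ^ 1) = C (8 * c) * X ^ 3 + C (4 * c * σ) * X ^ 1 := by
  simp only [lameOp, derivative_C_mul, pow_one, derivative_X, mul_one, derivative_C, zero_mul,
    zero_add, C_mul]
  simp only [map_ofNat]
  ring

/-- In these weights s⁴, σs² and ρ² all have weight 4 when σ = T/4 - 2ρ, while two derivatives in s
remove 2. Expanding σ splits its term into a T-part and a ρ-part, both with rational coefficients.
-/
theorem WForm.lameOp {w : ℕ} {Q : ℂ → ℂ → ℂ[X]} (h : WForm w Q) :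
    WForm (w + 2) fun ρ T => lameOp (T / 4 - 2 * ρ) ρ (Q ρ T) := by
  induction h with
  | monomial n i l c h =>
    match n, h with
    | 0, h =>
      have : (fun ρ T : ℂ => Goswami.lameOp (T / 4 - 2 * ρ) ρ (C ((c : ℂ) * ρ ^ i * T ^ l) * X ^ 0))
          = fun _ _ => 0 := by
        funext ρ T
        rw [Goswami.lameOp, pow_zero, mul_one, derivative_C, derivative_zero, zero_mul, zero_mul,
          add_zero]
      rw [this]
      exact WForm.zero _ ⟨i + l + 1, by lia⟩
    | 1, h =>
      have h1 := WForm.monomial (w := w + 2) 3 i l (8 * c) (by lia)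
      have h2 := WForm.monomial (w := w + 2) 1 i (l + 1) c (by lia)
      have h3 := WForm.monomial (w := w + 2) 1 (i + 1) l (-8 * c) (by lia)
      convert h1.add (h2.add h3) using 3
      rw [lameOp_monomial_one, ← add_mul, ← C_add]
      congr 2
      · congr 1; push_cast; ring
      · congr 1; push_cast; ring
    | m + 2, h =>
      have h1 := WForm.monomial (w := w + 2) (m + 4) i l (4 * c * (m + 2) * (m + 3)) (by lia)
      have h2 := WForm.monomial (w := w + 2) (m + 2) i (l + 1) (c * (m + 2) ^ 2) (by lia)
      have h3 := WForm.monomial (w := w + 2) (m + 2) (i + 1) l (-8 * c * (m + 2) ^ 2) (by lia)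
      have h4 := WForm.monomial (w := w + 2) m (i + 2) l (4 * c * (m + 2) * (m + 1)) (by lia)
      convert (h1.add (h2.add h3)).add h4 using 3
      rw [lameOp_monomial_add_two, ← add_mul, ← C_add]
      congr 3
      · congr 1; push_cast; ring
      · congr 1; push_cast; ring
      · push_cast; ring
  | add _ _ ih1 ih2 =>
    convert ih1.add ih2 using 3
    simp only [Goswami.lameOp, derivative_add]
    ring

theorem WForm.iterate {w : ℕ} {Q : ℂ → ℂ → ℂ[X]} (h : WForm w Q) (j : ℕ) :
    WForm (w + 2 * j) fun ρ T => (Goswami.lameOp (T / 4 - 2 * ρ) ρ)^[j] (Q ρ T) := by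
  induction j with
  | zero => exact h
  | succ j ih =>
    simp only [Function.iterate_succ_apply']
    exact ih.lameOp

theorem WForm.exists_coeff {w e m : ℕ} {Q : ℂ → ℂ → ℂ[X]} (h : WForm w Q) (hw : w = 2 * m + e) :
    ∃ β : ℕ → ℚ, ∀ ρ T : ℂ,
      (Q ρ T).coeff e = ∑ i ∈ Finset.range (m + 1), (β i : ℂ) * (ρ ^ i * T ^ (m - i)) := by
  induction h with
  | monomial n i l c h =>
    by_cases hn : n = e
    · refine ⟨Pi.single i c, fun ρ T => ?_⟩
      rw [Finset.sum_eq_single i]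
      · rw [coeff_C_mul_X_pow, if_pos hn.symm, Pi.single_eq_same, show m - i = l by lia]
        ring
      · intro j _ hj
        rw [Pi.single_eq_of_ne hj]; simp
      · intro hi
        simp at hi; lia
    · refine ⟨0, fun ρ T => ?_⟩
      rw [coeff_C_mul_X_pow, if_neg (fun h => hn h.symm)]
      simp
  | add _ _ ih1 ih2 =>
    obtain ⟨β, hβ⟩ := ih1
    obtain ⟨γ, hγ⟩ := ih2
    refine ⟨β + γ, fun ρ T => ?_⟩
    rw [coeff_add, hβ, hγ, ← Finset.sum_add_distrib]
    refine Finset.sum_congr rfl fun i _ => ?_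
    rw [Pi.add_apply]; push_cast; ring

/-- In the even case this extracts a factor F² from the moments, so the resulting polynomial in F
and T has no pure power of T. -/
theorem coeff_zero_lameOp (σ ρ : ℂ) (Q : ℂ[X]) :
    (lameOp σ ρ Q).coeff 0 = 8 * ρ ^ 2 * Q.coeff 2 := by
  rw [coeff_zero_eq_eval_zero]
  simp only [lameOp, eval_add, eval_mul, eval_C, eval_pow, eval_X, eval_ofNat,
    ← coeff_zero_eq_eval_zero, coeff_derivative]
  norm_num
  ring

end WeightedForms

/-! ### The degenerate case T = 0 and Bernoulli numbers -/

section Tanh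
open PowerSeries

/-- The formal power series of `tanh (2 u)`. -/
def tanhSeries : PowerSeries ℂ := 1 - 2 * (exp ℂ ^ 4 + 1)⁻¹

theorem constantCoeff_exp_pow_add_one : constantCoeff (exp ℂ ^ 4 + 1) ≠ 0 := by
  rw [map_add, map_pow, constantCoeff_exp]; norm_num

theorem constantCoeff_tanhSeries : constantCoeff tanhSeries = 0 := by
  rw [tanhSeries, map_sub, map_mul, PowerSeries.constantCoeff_inv, map_add, map_pow,
    constantCoeff_exp, map_one, map_ofNat]
  norm_num

theorem derivative_tanhSeries : derivative ℂ tanhSeries = 2 * (1 - tanhSeries ^ 2) := by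
  have h := PowerSeries.mul_inv_cancel _ constantCoeff_exp_pow_add_one
  have h1 : derivative ℂ (exp ℂ ^ 4 + 1) = 4 * exp ℂ ^ 4 := by
    rw [map_add, derivative_pow, derivative_exp]
    simp; ring
  have h2 : derivative ℂ (2 : PowerSeries ℂ) = 0 := by
    rw [← map_ofNat (C : ℂ →+* PowerSeries ℂ), derivative_C]
  rw [tanhSeries, map_sub, Derivation.leibniz, derivative_inv', h1, h2]
  simp only [smul_eq_mul, Derivation.map_one_eq_zero]
  generalize (exp ℂ ^ 4 + 1)⁻¹ = g at *
  linear_combination 8 * g * h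

theorem derivative_aeval_tanhSeries (Q : Polynomial ℂ) :
    derivative ℂ (Polynomial.aeval tanhSeries Q) =
      Polynomial.aeval tanhSeries Q.derivative * (2 * (1 - tanhSeries ^ 2)) := by
  rw [Derivation.map_aeval, derivative_tanhSeries, smul_eq_mul]

/-- For t = tanh(2u) one has t' = 2(1 - t²), so (t')² = 4(t⁴ - 2t² + 1). These are the parameters σ
= T/4 - 2ρ and ρ at T = 0, ρ = 1. -/
theorem derivative_derivative_aeval_tanhSeries (Q : Polynomial ℂ) :
    derivative ℂ (derivative ℂ (Polynomial.aeval tanhSeries Q)) =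
      Polynomial.aeval tanhSeries (lameOp (-2) 1 Q) := by
  have h2 : derivative ℂ (2 : PowerSeries ℂ) = 0 := by
    rw [← map_ofNat (C : ℂ →+* PowerSeries ℂ), derivative_C]
  rw [derivative_aeval_tanhSeries, Derivation.leibniz, derivative_aeval_tanhSeries,
    Derivation.leibniz, h2, map_sub, derivative_pow, derivative_tanhSeries]
  simp only [lameOp, map_add, map_mul, map_pow, map_ofNat, Polynomial.aeval_X, map_neg, map_one,
    smul_eq_mul, Derivation.map_one_eq_zero]
  push_cast
  ring

theorem iterate_derivative_aeval_tanhSeries (Q : Polynomial ℂ) (j : ℕ) :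
    (derivative ℂ)^[2 * j] (Polynomial.aeval tanhSeries Q) =
      Polynomial.aeval tanhSeries ((lameOp (-2) 1)^[j] Q) := by
  induction j with
  | zero => rfl
  | succ j ih =>
    rw [show 2 * (j + 1) = 2 * j + 1 + 1 by ring, Function.iterate_succ_apply',
      Function.iterate_succ_apply', ih, derivative_derivative_aeval_tanhSeries,
      Function.iterate_succ_apply']

theorem constantCoeff_aeval_tanhSeries (Q : Polynomial ℂ) :
    constantCoeff (Polynomial.aeval tanhSeries Q) = Q.coeff 0 := by
  rw [Polynomial.aeval_def, Polynomial.hom_eval₂, constantCoeff_tanhSeries,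
    Polynomial.coeff_zero_eq_eval_zero, Polynomial.eval]
  congr 1

/-- With E = e^{4x} the source is 4x/(E - 1) - 8x/(E² - 1) = 4x/(E + 1), a difference of two
rescaled Bernoulli generating series. -/
theorem coeff_tanhSeries (n : ℕ) : coeff n tanhSeries * (n + 1).factorial =
    (if n = 0 then 1 else 0) + 2 * 4 ^ n * (2 ^ (n + 1) - 1) * bernoulli (n + 1) := by
  have hB := bernoulliPowerSeries_mul_exp_sub_one ℂ
  have h4 := congrArg (rescale (4 : ℂ)) hB
  have h8 := congrArg (rescale (8 : ℂ)) hB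
  have e4 := exp_pow_eq_rescale_exp (A := ℂ) 4
  have e8 := exp_pow_eq_rescale_exp (A := ℂ) 8
  push_cast at e4 e8
  rw [map_mul, map_sub, map_one, ← e4, rescale_X] at h4
  rw [map_mul, map_sub, map_one, ← e8, rescale_X] at h8
  have h := PowerSeries.mul_inv_cancel _ constantCoeff_exp_pow_add_one
  set g := (exp ℂ ^ 4 + 1)⁻¹ with hg
  set B4 := rescale (4 : ℂ) (bernoulliPowerSeries ℂ) with hB4
  set B8 := rescale (8 : ℂ) (bernoulliPowerSeries ℂ) with hB8
  -- Otherwise `h4` would make 4X vanish, as its coefficient of degree 1 shows.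
  have hne : exp ℂ ^ 4 - 1 ≠ 0 := by
    intro h0
    rw [h0, mul_zero] at h4
    have := congrArg (coeff 1) h4
    simp at this
  have key : B4 - B8 = C 4 * X * g := by
    refine mul_right_cancel₀ hne ?_
    have h8' : B8 * (exp ℂ ^ 4 - 1) = C 8 * X * g := by
      linear_combination g * h8 - B8 * (exp ℂ ^ 4 - 1) * h
    have hC : (C 8 : PowerSeries ℂ) = 2 * C 4 := by
      rw [← map_ofNat (C : ℂ →+* PowerSeries ℂ) 2, ← map_mul]; norm_num
    linear_combination h4 - h8' - C 4 * X * h + (-X * g) * hC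
  have hc := congrArg (coeff (n + 1)) key
  rw [map_sub, hB4, hB8, coeff_rescale, coeff_rescale, mul_assoc, coeff_C_mul,
    coeff_succ_X_mul, bernoulliPowerSeries, coeff_mk, eq_ratCast] at hc
  have hs : coeff n tanhSeries = (if n = 0 then 1 else 0) - 2 * coeff n g := by
    rw [tanhSeries, map_sub, coeff_one, ← map_ofNat (C : ℂ →+* PowerSeries ℂ) 2, coeff_C_mul]
  have hf : ((n + 1).factorial : ℂ) ≠ 0 := by exact_mod_cast (n + 1).factorial_ne_zero
  rw [hs, show coeff n g = (4 ^ (n + 1) * ((bernoulli (n + 1) / (n + 1).factorial : ℚ) : ℂ) -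
    8 ^ (n + 1) * ((bernoulli (n + 1) / (n + 1).factorial : ℚ) : ℂ)) / 4 by rw [hc]; ring]
  rw [show (8 : ℂ) ^ (n + 1) = 4 ^ (n + 1) * 2 ^ (n + 1) by rw [← mul_pow]; norm_num]
  push_cast at hf ⊢
  field_simp
  split_ifs with h0
  · subst h0; simp; ring
  · ring

theorem coeff_one_iterate_lameOp (j : ℕ) :
    2 * ((lameOp (-2) 1)^[j] Polynomial.X).coeff 1 =
      (2 * j + 1).factorial * coeff (2 * j + 1) tanhSeries := by
  have h := constantCoeff_iterate_derivative tanhSeries (2 * j + 1)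
  have h1 := iterate_derivative_aeval_tanhSeries Polynomial.X j
  rw [Polynomial.aeval_X] at h1
  rw [Function.iterate_succ_apply', h1, derivative_aeval_tanhSeries] at h
  rw [map_mul, constantCoeff_aeval_tanhSeries, Polynomial.coeff_derivative] at h
  simp only [map_mul, map_sub, map_pow, constantCoeff_tanhSeries, map_one, map_ofNat] at h
  rw [← h]; push_cast; ring

/-- Derivatives of t² reduce to those of t because t² = 1 - t'/2; this is where the minus sign
arises. -/
theorem coeff_zero_iterate_lameOp (j : ℕ) :
    2 * ((lameOp (-2) 1)^[j + 1] (Polynomial.X ^ 2)).coeff 0 =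
      -((2 * j + 3).factorial * coeff (2 * j + 3) tanhSeries) := by
  have h := constantCoeff_iterate_derivative (tanhSeries ^ 2) (2 * (j + 1))
  have h1 := iterate_derivative_aeval_tanhSeries (Polynomial.X ^ 2) (j + 1)
  rw [map_pow, Polynomial.aeval_X] at h1
  rw [h1, constantCoeff_aeval_tanhSeries] at h
  have h2 := congrArg (coeff (2 * (j + 1))) derivative_tanhSeries
  rw [coeff_derivative, show (2 : PowerSeries ℂ) = C 2 from (map_ofNat C 2).symm, coeff_C_mul,
    map_sub, coeff_one,
    if_neg (by lia)] at h2
  rw [h, show 2 * j + 3 = 2 * (j + 1) + 1 by ring, Nat.factorial_succ]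
  push_cast at h2 ⊢
  linear_combination ((2 * (j + 1)).factorial : ℂ) * h2

end Tanh

/-! ### Stirling numbers and the power sums ∑ mⁿ zᵐ -/

section Stirling

theorem mul_descFactorial (m j : ℕ) :
    m * m.descFactorial j = m.descFactorial (j + 1) + j * m.descFactorial j := by
  rw [Nat.descFactorial_succ, ← add_mul]
  rcases le_or_gt j m with h | h
  · rw [Nat.sub_add_cancel h]
  · rw [Nat.descFactorial_of_lt h]; simp

theorem pow_eq_sum_stirlingSecond_mul_descFactorial (n m : ℕ) :
    m ^ n = ∑ j ∈ Finset.range (n + 1), n.stirlingSecond j * m.descFactorial j := by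
  induction n with
  | zero => simp
  | succ n ih =>
    have h1 : ∑ j ∈ Finset.range (n + 1),
        (j + 1) * n.stirlingSecond (j + 1) * m.descFactorial (j + 1) =
        ∑ j ∈ Finset.range (n + 1), j * n.stirlingSecond j * m.descFactorial j := by
      have h2 := Finset.sum_range_succ'
        (fun j => j * n.stirlingSecond j * m.descFactorial j) (n + 1)
      rw [Finset.sum_range_succ, Nat.stirlingSecond_eq_zero_of_lt (Nat.lt_succ_self n)] at h2
      simpa using h2.symm
    rw [Finset.sum_range_succ', Nat.stirlingSecond_succ_zero, zero_mul, add_zero]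
    simp only [Nat.stirlingSecond_succ_succ, add_mul _ (n.stirlingSecond _) (m.descFactorial _),
      Finset.sum_add_distrib]
    rw [h1, pow_succ, ih, Finset.sum_mul, ← Finset.sum_add_distrib]
    refine Finset.sum_congr rfl fun j _ => ?_
    have := mul_descFactorial m j
    linear_combination (n.stirlingSecond j) * this

variable {z : ℂ}

theorem hasSum_choose_mul_pow (hz : ‖z‖ < 1) (j : ℕ) :
    HasSum (fun m : ℕ => (m.choose j : ℂ) * z ^ m) (z ^ j / (1 - z) ^ (j + 1)) := by
  have h := (hasSum_choose_mul_geometric_of_norm_lt_one j hz).mul_left (z ^ j)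
  rw [← hasSum_nat_add_iff' j]
  rw [Finset.sum_eq_zero fun i hi => by
    rw [Nat.choose_eq_zero_of_lt (Finset.mem_range.mp hi)]; simp]
  rw [sub_zero, div_eq_mul_one_div]
  refine h.congr_fun fun m => ?_
  rw [pow_add]; ring

/-- The polynomial sum `∑_j S(n,j) j! z^j (1-z)^{n-j}`. -/
def eulerSum (n : ℕ) (z : ℂ) : ℂ :=
  ∑ j ∈ Finset.range (n + 1), (n.stirlingSecond j : ℂ) * j.factorial * (z ^ j * (1 - z) ^ (n - j))

/-- Expand mⁿ in the binomial coefficients of m by Stirling numbers and sum each one over m. -/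
theorem hasSum_pow_mul_pow (hz : ‖z‖ < 1) (n : ℕ) :
    HasSum (fun m : ℕ => (m : ℂ) ^ n * z ^ m) (eulerSum n z / (1 - z) ^ (n + 1)) := by
  have h1z : 1 - z ≠ 0 := by
    intro h
    rw [← sub_eq_zero.mp h, norm_one] at hz
    exact lt_irrefl _ hz
  have h : HasSum (fun m : ℕ => ∑ j ∈ Finset.range (n + 1),
      (n.stirlingSecond j : ℂ) * j.factorial * ((m.choose j : ℂ) * z ^ m))
      (∑ j ∈ Finset.range (n + 1),
        (n.stirlingSecond j : ℂ) * j.factorial * (z ^ j / (1 - z) ^ (j + 1))) := hasSum_sum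
    (fun j _ => (hasSum_choose_mul_pow hz j).mul_left ((n.stirlingSecond j : ℂ) * j.factorial))
  have e : eulerSum n z / (1 - z) ^ (n + 1) = ∑ j ∈ Finset.range (n + 1),
      (n.stirlingSecond j : ℂ) * j.factorial * (z ^ j / (1 - z) ^ (j + 1)) := by
    rw [eulerSum, Finset.sum_div]
    refine Finset.sum_congr rfl fun j hj => ?_
    have : n + 1 = (n - j) + (j + 1) := by have := Finset.mem_range.mp hj; lia
    rw [this, pow_add]
    field_simp
  rw [e]
  refine h.congr_fun fun m => ?_
  have := pow_eq_sum_stirlingSecond_mul_descFactorial n m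
  have h2 : (m : ℂ) ^ n = ∑ j ∈ Finset.range (n + 1),
      (n.stirlingSecond j : ℂ) * j.factorial * (m.choose j : ℂ) := by
    have h3 := congrArg (Nat.cast : ℕ → ℂ) this
    push_cast [Nat.descFactorial_eq_factorial_mul_choose] at h3
    rw [h3]
    exact Finset.sum_congr rfl fun j _ => by ring
  rw [h2, Finset.sum_mul]
  exact Finset.sum_congr rfl fun j _ => by ring

theorem sum_choose_mul_neg_pow {n r : ℕ} (h : r ≤ n) (x : ℂ) :
    ∑ l ∈ Finset.range (n + 1), (-1) ^ l * (r.choose l : ℂ) * x ^ l = (1 - x) ^ r := by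
  rw [sub_eq_neg_add, add_pow]
  refine (Finset.sum_subset (Finset.range_mono (by lia)) fun l _ hl => ?_).symm.trans
    (Finset.sum_congr rfl fun l _ => ?_)
  · rw [Nat.choose_eq_zero_of_lt (by simpa using hl)]; simp
  · rw [neg_pow x, one_pow]; ring

/-- The binomial theorem is used twice: the sum over l gives powers of 1 - z, and the sum over m
then gives (1 - z)^{n-j} (-1 + (1 - z))^j. -/
theorem sum_b_mul_pow {k n : ℕ} (hn : 2 * k = n + 1) (z : ℂ) :
    ∑ l ∈ Finset.range (n + 1), (-1) ^ l * (b k l : ℂ) * z ^ l = eulerSum n z := by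
  have h1 : ∀ l, (b k l : ℂ) = ∑ m ∈ Finset.range (n + 1),
      (-1) ^ m * (a k m : ℂ) * ((n - m).choose l : ℂ) := by
    intro l
    rw [b, hn]
    push_cast
    refine Finset.sum_congr rfl fun m _ => ?_
    rw [show n + 1 - m - 1 = n - m by lia]
  have h2 : ∀ m, (a k m : ℂ) = ∑ j ∈ Finset.range (n + 1),
      (j.factorial : ℂ) * (-1) ^ j * (n.stirlingSecond j : ℂ) * (j.choose m : ℂ) := by
    intro m
    rw [a, hn]
    push_cast
    simp
  have h3 : ∑ l ∈ Finset.range (n + 1), (-1) ^ l * (b k l : ℂ) * z ^ l =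
      ∑ m ∈ Finset.range (n + 1), (-1) ^ m * (a k m : ℂ) * (1 - z) ^ (n - m) := by
    simp only [h1, Finset.mul_sum, Finset.sum_mul]
    rw [Finset.sum_comm]
    refine Finset.sum_congr rfl fun m _ => ?_
    rw [← sum_choose_mul_neg_pow (n := n) (Nat.sub_le n m) z, Finset.mul_sum]
    exact Finset.sum_congr rfl fun l _ => by ring
  rw [h3, eulerSum]
  simp only [h2, Finset.mul_sum, Finset.sum_mul]
  rw [Finset.sum_comm]
  refine Finset.sum_congr rfl fun j hj => ?_
  have hj' : j ≤ n := Nat.lt_succ_iff.mp (Finset.mem_range.mp hj)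
  have h4 : ∑ m ∈ Finset.range (n + 1), (-1) ^ m * (j.choose m : ℂ) * (1 - z) ^ (n - m) =
      (1 - z) ^ (n - j) * (-z) ^ j := by
    rw [show -z = -1 + (1 - z) by ring, add_pow, Finset.mul_sum]
    refine (Finset.sum_subset (Finset.range_mono (by lia)) fun l _ hl => ?_).symm.trans
      (Finset.sum_congr rfl fun l hl => ?_)
    · rw [Nat.choose_eq_zero_of_lt (by simpa using hl)]; simp
    · have : n - l = (n - j) + (j - l) := by have := Finset.mem_range.mp hl; lia
      rw [this, pow_add]; ring
  have h5 : (n.stirlingSecond j : ℂ) * j.factorial * (z ^ j * (1 - z) ^ (n - j)) =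
      (j.factorial : ℂ) * (-1) ^ j * (n.stirlingSecond j : ℂ) * ((1 - z) ^ (n - j) * (-z) ^ j) := by
    rw [neg_pow z]
    have : ((-1 : ℂ) ^ j) * (-1) ^ j = 1 := by rw [← mul_pow]; norm_num
    linear_combination (-(n.stirlingSecond j : ℂ) * j.factorial * (z ^ j * (1 - z) ^ (n - j))) *
      this
  rw [h5, ← h4, Finset.mul_sum]
  exact Finset.sum_congr rfl fun m _ => by ring

theorem mul_aeval_Pe {k n : ℕ} (hn : 2 * k = n + 1) (hn0 : n ≠ 0) (z : ℂ) :
    z * Polynomial.aeval z (Pe k) = eulerSum n z := by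
  -- `Pe` omits the index l = 0. Nothing is lost, because `eulerSum n 0 = 0` for n ≠ 0.
  have h0 : (b k 0 : ℂ) = 0 := by
    have h := sum_b_mul_pow hn 0
    rw [Finset.sum_range_succ', Finset.sum_eq_zero fun l _ => by simp, eulerSum,
      Finset.sum_range_succ', Finset.sum_eq_zero fun l _ => by simp] at h
    obtain ⟨m, rfl⟩ := Nat.exists_eq_succ_of_ne_zero hn0
    simpa using h
  rw [← sum_b_mul_pow hn, Finset.sum_range_succ', h0, Pe, map_sum, show 2 * k - 1 = n by lia,
    Finset.mul_sum, ← Finset.Ico_add_one_right_eq_Icc, Finset.sum_Ico_eq_sum_range,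
    Nat.add_sub_cancel, mul_zero, zero_mul, add_zero]
  refine Finset.sum_congr rfl fun l _ => ?_
  rw [add_comm 1 l, Nat.add_sub_cancel, map_mul, map_pow, Polynomial.aeval_X, Polynomial.aeval_C,
    eq_intCast]
  push_cast
  ring

end Stirling

/-! ### Lambert series and the expansion of `G` in F and T -/

section Lambert

variable {q : ℂ}

theorem one_sub_ne_zero_of_norm_lt {z : ℂ} (hz : ‖z‖ < 1) : 1 - z ≠ 0 := by
  intro h
  rw [← sub_eq_zero.mp h, norm_one] at hz
  exact lt_irrefl _ hz

theorem norm_pow_lt_one {z : ℂ} (hz : ‖z‖ < 1) {n : ℕ} (hn : n ≠ 0) : ‖z ^ n‖ < 1 := by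
  rw [norm_pow]; exact pow_lt_one₀ (norm_nonneg _) hz hn

theorem hasSum_Pe {z : ℂ} (hz : ‖z‖ < 1) (j : ℕ) :
    HasSum (fun m : ℕ => (m : ℂ) ^ (2 * j + 1) * z ^ m)
      (z * Polynomial.aeval z (Pe (j + 1)) / (1 - z) ^ (2 * (j + 1))) := by
  rw [mul_aeval_Pe (n := 2 * j + 1) (by ring) (by lia)]
  exact hasSum_pow_mul_pow hz (2 * j + 1)

theorem summable_lambert (hq : ‖q‖ < 1) (p : ℕ) :
    Summable fun x : ℕ × ℕ => (x.2 : ℂ) ^ (p + 1) * q ^ ((2 * x.1 + 1) * x.2) := by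
  have h1 : Summable fun n : ℕ => ‖q‖ ^ n := summable_geometric_of_lt_one (norm_nonneg _) hq
  have h2 : Summable fun n : ℕ => (n : ℝ) ^ (p + 1) * ‖q‖ ^ n :=
    summable_pow_mul_geometric_of_norm_lt_one (p + 1) (by rwa [norm_norm])
  have h3 : Summable fun x : ℕ × ℕ => ‖q‖ ^ x.1 * ((x.2 : ℝ) ^ (p + 1) * ‖q‖ ^ x.2) :=
    h1.mul_of_nonneg h2 (fun _ => by positivity) (fun _ => by positivity)
  refine Summable.of_norm (h3.of_nonneg_of_le (fun _ => norm_nonneg _) fun x => ?_)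
  obtain ⟨n, m⟩ := x
  simp only [norm_mul, norm_pow, Complex.norm_natCast]
  rcases Nat.eq_zero_or_pos m with rfl | hm
  · simp
  · have : ‖q‖ ^ ((2 * n + 1) * m) ≤ ‖q‖ ^ (n + m) :=
      pow_le_pow_of_le_one (norm_nonneg _) hq.le (by nlinarith)
    calc (m : ℝ) ^ (p + 1) * ‖q‖ ^ ((2 * n + 1) * m) ≤ (m : ℝ) ^ (p + 1) * ‖q‖ ^ (n + m) := by
          gcongr
      _ = _ := by rw [pow_add]; ring

theorem tsum_lambert (hq : ‖q‖ < 1) (p m : ℕ) :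
    ∑' n : ℕ, (m : ℂ) ^ (p + 1) * q ^ ((2 * n + 1) * m) = (m : ℂ) ^ (p + 1) * sinhCoeff q m := by
  rcases Nat.eq_zero_or_pos m with rfl | hm
  · simp
  rw [tsum_mul_left, sinhCoeff, zpow_natCast]
  congr 1
  have h := (hasSum_geometric_of_norm_lt_one (norm_pow_lt_one (norm_pow_lt_one hq hm.ne')
    (two_ne_zero))).mul_left (q ^ m)
  rw [div_eq_mul_inv]
  refine (h.congr_fun fun n => ?_).tsum_eq
  rw [← pow_mul, ← pow_mul, ← pow_add]
  congr 1; ring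

theorem tsum_lambert_comp (hq : ‖q‖ < 1) (p : ℕ) {e : ℕ → ℕ} (he : Function.Injective e) :
    ∑' n : ℕ, ∑' m : ℕ, (e m : ℂ) ^ (p + 1) * q ^ ((2 * n + 1) * e m) =
      ∑' m : ℕ, (e m : ℂ) ^ (p + 1) * sinhCoeff q (e m) := by
  have h : Summable fun x : ℕ × ℕ => (e x.2 : ℂ) ^ (p + 1) * q ^ ((2 * x.1 + 1) * e x.2) :=
    (summable_lambert hq p).comp_injective (i := Prod.map id e)
      (Function.Injective.prodMap Function.injective_id he)
  refine (Summable.tsum_comm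
    (f := fun n m => (e m : ℂ) ^ (p + 1) * q ^ ((2 * n + 1) * e m)) h).symm.trans ?_
  exact tsum_congr fun m => tsum_lambert hq p (e m)

theorem term_of_even (hq : ‖q‖ < 1) {j : ℕ} (hj : ¬ Odd (j + 1)) (n : ℕ) :
    term (j + 1) q n =
      ∑' m : ℕ, ((2 * m : ℕ) : ℂ) ^ (2 * j + 1) * q ^ ((2 * n + 1) * (2 * m)) := by
  have h := (hasSum_Pe (norm_pow_lt_one hq (show 4 * n + 2 ≠ 0 by lia)) j).mul_left
    (2 ^ (2 * (j + 1) - 1))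
  rw [term, if_neg hj, ← h.tsum_eq]
  refine tsum_congr fun m => ?_
  rw [← pow_mul, show 2 * (j + 1) - 1 = 2 * j + 1 by lia]
  push_cast
  rw [mul_pow, show (4 * n + 2) * m = (2 * n + 1) * (2 * m) by ring]
  ring

/-- `Po` is the numerator of the sum over all m minus the sum over even m, over the common
denominator (1 - x²)^{2k}; this explains its factor (1 + z)^{2k} and its subtracted term in z². -/
theorem term_of_odd (hq : ‖q‖ < 1) {j : ℕ} (hj : Odd (j + 1)) (n : ℕ) :
    term (j + 1) q n =
      ∑' m : ℕ, ((2 * m + 1 : ℕ) : ℂ) ^ (2 * j + 1) * q ^ ((2 * n + 1) * (2 * m + 1)) := by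
  set x := q ^ (2 * n + 1) with hx
  have hxn : ‖x‖ < 1 := norm_pow_lt_one hq (by lia)
  have hx2 : q ^ (4 * n + 2) = x ^ 2 := by rw [hx, ← pow_mul]; congr 1; ring
  have hx2n : ‖x ^ 2‖ < 1 := norm_pow_lt_one hxn two_ne_zero
  have h1 := hasSum_Pe hxn j
  have h2 := (hasSum_Pe hx2n j).mul_left (2 ^ (2 * j + 1))
  have h2' : HasSum (fun m : ℕ => ((2 * m : ℕ) : ℂ) ^ (2 * j + 1) * x ^ (2 * m))
      (2 ^ (2 * j + 1) * (x ^ 2 * Polynomial.aeval (x ^ 2) (Pe (j + 1)) /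
        (1 - x ^ 2) ^ (2 * (j + 1)))) := by
    refine h2.congr_fun fun m => ?_
    rw [← pow_mul]; push_cast; rw [mul_pow]; ring
  have h3 : Summable fun m : ℕ => ((2 * m + 1 : ℕ) : ℂ) ^ (2 * j + 1) * x ^ (2 * m + 1) :=
    h1.summable.comp_injective (i := fun m => 2 * m + 1) (fun a b h => by simpa using h)
  have h4 := (HasSum.even_add_odd (f := fun m : ℕ => (m : ℂ) ^ (2 * j + 1) * x ^ m)
    h2' h3.hasSum).unique h1
  have h5 : ∑' m : ℕ, ((2 * m + 1 : ℕ) : ℂ) ^ (2 * j + 1) * q ^ ((2 * n + 1) * (2 * m + 1)) =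
      ∑' m : ℕ, ((2 * m + 1 : ℕ) : ℂ) ^ (2 * j + 1) * x ^ (2 * m + 1) := by
    refine tsum_congr fun m => ?_
    rw [hx, ← pow_mul]
  rw [term, if_pos hj, h5, ← sub_eq_of_eq_add' h4.symm, ← hx, hx2, Po]
  simp only [map_sub, map_mul, map_pow, map_add, map_one, map_ofNat, Polynomial.aeval_X,
    Polynomial.aeval_comp]
  have e1 := one_sub_ne_zero_of_norm_lt hxn
  have e2 : 1 + x ≠ 0 := by
    have := one_sub_ne_zero_of_norm_lt (z := -x) (by rwa [norm_neg])
    rwa [sub_neg_eq_add] at this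
  rw [show (1 : ℂ) - x ^ 2 = (1 - x) * (1 + x) by ring, mul_pow,
    show 2 * (j + 1) - 1 = 2 * j + 1 by lia]
  field_simp

theorem G_of_even (hq : ‖q‖ < 1) {j : ℕ} (hj : ¬ Odd (j + 1)) :
    G (j + 1) q = ∑' m : ℕ, ((2 * m : ℕ) : ℂ) ^ (2 * j + 1) * sinhCoeff q (2 * m : ℕ) := by
  rw [G, tsum_congr (term_of_even hq hj)]
  exact tsum_lambert_comp hq (2 * j) (e := fun m => 2 * m) (fun a b h => by simpa using h)

theorem G_of_odd (hq : ‖q‖ < 1) {j : ℕ} (hj : Odd (j + 1)) :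
    G (j + 1) q = ∑' m : ℕ, ((2 * m + 1 : ℕ) : ℂ) ^ (2 * j + 1) * sinhCoeff q (2 * m + 1 : ℕ) := by
  rw [G, tsum_congr (term_of_odd hq hj)]
  exact tsum_lambert_comp hq (2 * j) (e := fun m => 2 * m + 1) (fun a b h => by simpa using h)

theorem tsum_int_of_even {f : ℤ → ℂ} (hf : Summable f) (h0 : f 0 = 0) (h : ∀ n, f (-n) = f n) :
    ∑' n : ℤ, f n = 2 * ∑' n : ℕ, f n := by
  have h1 : HasSum (fun n : ℕ => f n) (∑' n : ℕ, f n) :=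
    (hf.comp_injective (i := ((↑) : ℕ → ℤ)) Nat.cast_injective).hasSum
  have h2 : HasSum (fun n : ℕ => f (-n)) (∑' n : ℕ, f n) := by simpa only [h] using h1
  rw [(h1.of_nat_of_neg h2).tsum_eq, h0]; ring

theorem two_mul_G_of_even (hq0 : q ≠ 0) (hq : ‖q‖ < 1) {j : ℕ} (hj : ¬ Odd (j + 1)) :
    2 * G (j + 1) q =
      ∑' n : ℤ, (n : ℂ) ^ (2 * j + 1) * (if Even n then sinhCoeff q n else 0) := by
  have hs : Summable fun n : ℤ => (n : ℂ) ^ (2 * j + 1) * (if Even n then sinhCoeff q n else 0) :=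
    (((rapid_sinhCoeff hq0 hq).ite fun n => Even n) (2 * j + 1)).of_norm
  rw [tsum_int_of_even hs (by simp) (fun n => by
    simp only [even_neg, sinhCoeff_neg hq0, Int.cast_neg, Odd.neg_pow (odd_two_mul_add_one j)]
    split_ifs <;> ring), G_of_even hq hj]
  have h1 := hs.comp_injective (i := ((↑) : ℕ → ℤ)) Nat.cast_injective
  rw [← tsum_even_add_odd (f := fun n : ℕ => ((n : ℤ) : ℂ) ^ (2 * j + 1) *
      (if Even (n : ℤ) then sinhCoeff q n else 0))
    (h1.comp_injective (i := fun m => 2 * m) (fun a b h => by simpa using h))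
    (h1.comp_injective (i := fun m => 2 * m + 1) (fun a b h => by simpa using h))]
  simp [parity_simps, show ∀ k : ℤ, ¬ Odd (2 * k) from fun k =>
    Int.not_odd_iff_even.mpr (even_two_mul k)]

theorem two_mul_G_of_odd (hq0 : q ≠ 0) (hq : ‖q‖ < 1) {j : ℕ} (hj : Odd (j + 1)) :
    2 * G (j + 1) q = ∑' n : ℤ, (n : ℂ) ^ (2 * j + 1) * oddSinhCoeff q n := by
  have hs : Summable fun n : ℤ => (n : ℂ) ^ (2 * j + 1) * oddSinhCoeff q n :=
    ((rapid_oddSinhCoeff hq0 hq) (2 * j + 1)).of_norm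
  rw [tsum_int_of_even hs (by simp) (fun n => by
    simp only [oddSinhCoeff_neg hq0, Int.cast_neg, Odd.neg_pow (odd_two_mul_add_one j)]
    ring), G_of_odd hq hj]
  have h1 := hs.comp_injective (i := ((↑) : ℕ → ℤ)) Nat.cast_injective
  rw [← tsum_even_add_odd (f := fun n : ℕ => ((n : ℤ) : ℂ) ^ (2 * j + 1) * oddSinhCoeff q n)
    (h1.comp_injective (i := fun m => 2 * m) (fun a b h => by simpa using h))
    (h1.comp_injective (i := fun m => 2 * m + 1) (fun a b h => by simpa using h))]
  simp [oddSinhCoeff, show ∀ k : ℤ, ¬ Odd (2 * k) from fun k =>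
    Int.not_odd_iff_even.mpr (even_two_mul k)]

theorem factorial_mul_coeff_tanhSeries (j : ℕ) :
    (2 * j + 1).factorial * PowerSeries.coeff (2 * j + 1) tanhSeries =
      -2 * (-1) ^ (j + 1) * (Z (j + 1) : ℂ) := by
  have hT := coeff_tanhSeries (2 * j + 1)
  rw [if_neg (by lia), show 2 * j + 1 + 1 = 2 * (j + 1) by ring, pow_mul 2 2 (j + 1),
    show (2 * (j + 1)).factorial = (2 * j + 1 + 1) * (2 * j + 1).factorial from
      Nat.factorial_succ (2 * j + 1), pow_succ, pow_mul] at hT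
  have h0 : (j : ℂ) + 1 ≠ 0 := by exact_mod_cast Nat.succ_ne_zero j
  have hs : ((-1 : ℂ) ^ (j + 1)) * (-1) ^ (j + 1) = 1 := by rw [← mul_pow]; norm_num
  rw [Z, neg_pow (16 : ℚ)]
  push_cast at hT ⊢
  norm_num at hT
  generalize (-1 : ℂ) ^ (j + 1) = ε at *
  generalize PowerSeries.coeff (2 * j + 1) tanhSeries = c at *
  generalize ((2 * j + 1).factorial : ℂ) = f at *
  rw [pow_succ 16 j]
  field_simp
  linear_combination 4 * hT - (2 * 16 ^ j * 4 * 4 * (4 ^ (j + 1) - 1) *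
    bernoulli (2 * (j + 1))) * hs

/-- `𝒢_{2k}` is a polynomial in the two modular forms `formF` and `formT`. -/
theorem exists_G_eq_sum {k : ℕ} (hk : 0 < k) : ∃ α : ℕ → ℚ, ∀ q : ℂ, q ≠ 0 → ‖q‖ < 1 →
    G k q = ∑ j ∈ Finset.Icc 1 (k - 1), (α j : ℂ) * (formF q ^ j * formT q ^ (k - j)) +
      (Z k : ℂ) * formF q ^ k := by
  obtain ⟨j, rfl⟩ := Nat.exists_eq_succ_of_ne_zero hk.ne'
  simp only [Nat.succ_eq_add_one, Nat.add_sub_cancel]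
  suffices H : ∃ β : ℕ → ℚ, β (j + 1) = Z (j + 1) ∧ ∀ q : ℂ, q ≠ 0 → ‖q‖ < 1 →
      G (j + 1) q = ∑ i ∈ Finset.range (j + 1),
        (β (i + 1) : ℂ) * (formF q ^ (i + 1) * formT q ^ (j - i)) by
    obtain ⟨β, hβ, h⟩ := H
    refine ⟨β, fun q hq0 hq => ?_⟩
    rw [h q hq0 hq, Finset.sum_range_succ, hβ, Nat.sub_self, pow_zero, mul_one,
      ← Finset.Ico_add_one_right_eq_Icc, Finset.sum_Ico_eq_sum_range, Nat.add_sub_cancel]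
    congr 1
    refine Finset.sum_congr rfl fun i _ => ?_
    rw [add_comm 1 i, show j + 1 - (i + 1) = j - i by lia]
  by_cases hj : Odd (j + 1)
  · obtain ⟨β, hβ⟩ := ((WForm.monomial 1 0 0 1 rfl).iterate j).exists_coeff (e := 1) (m := j)
      (by ring)
    refine ⟨fun i => β (i - 1), ?_, fun q hq0 hq => ?_⟩
    -- At T = 0 and F = 1 only the top power of F survives, so its coefficient is the one computed
    -- from tanh(2u).
    · have h1 := hβ 1 0
      rw [Finset.sum_eq_single j (fun i hi hij => by
        rw [zero_pow (by have := Finset.mem_range.mp hi; lia)]; simp) (by simp)] at h1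
      simp only [Nat.sub_self, pow_zero, one_pow, mul_one, Rat.cast_one, map_one, one_mul,
        pow_one] at h1
      have h2 := coeff_one_iterate_lameOp j
      rw [show (0 : ℂ) / 4 - 2 = -2 by norm_num] at h1
      rw [h1] at h2
      rw [factorial_mul_coeff_tanhSeries, hj.neg_one_pow] at h2
      have h3 : (β j : ℂ) = Z (j + 1) := by linear_combination 1 / 2 * h2
      exact_mod_cast h3
    · have h1 := tsum_oddSinhCoeff hq0 hq j
      rw [← two_mul_G_of_odd hq0 hq hj] at h1
      have h2 := hβ (formF q) (formT q)
      simp only [pow_zero, mul_one, Rat.cast_one, map_one, one_mul, pow_one] at h2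
      rw [h2] at h1
      have h3 : G (j + 1) q = formF q * ∑ i ∈ Finset.range (j + 1),
        (β i : ℂ) * (formF q ^ i * formT q ^ (j - i)) := by linear_combination 1 / 2 * h1
      rw [h3, Finset.mul_sum]
      refine Finset.sum_congr rfl fun i _ => ?_
      dsimp only
      rw [Nat.add_sub_cancel, pow_succ]; ring
  · obtain ⟨l, rfl⟩ : ∃ l, j = l + 1 := Nat.exists_eq_succ_of_ne_zero (by rintro rfl; simp at hj)
    obtain ⟨β, hβ⟩ := ((WForm.monomial 2 0 0 1 rfl).iterate l).exists_coeff (e := 2) (m := l)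
      (by ring)
    -- The shift by 2 and the factor 8 come from the factor 8F² of `coeff_zero_lameOp`.
    refine ⟨fun i => if i < 2 then 0 else 8 * β (i - 2), ?_, fun q hq0 hq => ?_⟩
    · have h1 := hβ 1 0
      rw [Finset.sum_eq_single l (fun i hi hij => by
        rw [zero_pow (by have := Finset.mem_range.mp hi; lia)]; simp) (by simp)] at h1
      simp only [Nat.sub_self, pow_zero, one_pow, mul_one, Rat.cast_one, map_one, one_mul] at h1
      have h2 := coeff_zero_iterate_lameOp l
      rw [show (0 : ℂ) / 4 - 2 = -2 by norm_num] at h1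
      rw [Function.iterate_succ_apply', coeff_zero_lameOp, h1] at h2
      rw [show 2 * l + 3 = 2 * (l + 1) + 1 by ring, factorial_mul_coeff_tanhSeries,
        (Nat.not_odd_iff_even.mp hj).neg_one_pow] at h2
      dsimp only
      rw [if_neg (by lia), show l + 1 + 1 - 2 = l by lia]
      have h3 : ((8 * β l : ℚ) : ℂ) = Z (l + 1 + 1) := by
        push_cast
        linear_combination 1 / 2 * h2
      exact_mod_cast h3
    · have h1 := tsum_evenSinhCoeff hq0 hq l
      rw [show 2 * l + 3 = 2 * (l + 1) + 1 by ring, ← two_mul_G_of_even hq0 hq hj,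
        Function.iterate_succ_apply', coeff_zero_lameOp] at h1
      have h2 := hβ (formF q) (formT q)
      simp only [pow_zero, mul_one, Rat.cast_one, map_one, one_mul] at h2
      rw [h2] at h1
      have h3 : G (l + 1 + 1) q = 8 * formF q ^ 2 * ∑ i ∈ Finset.range (l + 1),
        (β i : ℂ) * (formF q ^ i * formT q ^ (l - i)) := by linear_combination 1 / 2 * h1
      rw [h3, Finset.mul_sum, Finset.sum_range_succ' _ (l + 1)]
      dsimp only
      rw [if_pos (by lia)]
      simp only [Rat.cast_zero, zero_mul, add_zero]
      refine Finset.sum_congr rfl fun i _ => ?_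
      rw [if_neg (by lia), show l + 1 - (i + 1) = l - i by lia, show i + 1 + 1 - 2 = i by lia]
      push_cast
      ring

end Lambert

/-! ### Product identities for the theta quotients -/

section Products

variable {q : ℂ}

theorem neg_norm_lt (hq : ‖q‖ < 1) : ‖-q‖ < 1 := by rwa [norm_neg]

theorem qPoch_self_eq (q : ℂ) : qPoch q q = ∏' n : ℕ, (1 - q ^ (n + 1)) := by
  rw [qPoch]
  exact tprod_congr fun n => by rw [pow_succ']

theorem differentiableOn_qPoch_self :
    DifferentiableOn ℂ (fun q => qPoch q q) (Metric.ball (0 : ℂ) 1) :=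
  ModularForm.differentiableOn_tprod_one_sub_pow.congr fun q _ => qPoch_self_eq q

theorem qPoch_self_zero : qPoch 0 0 = 1 := by
  rw [qPoch_self_eq]; simp

theorem qPoch_self_ne_zero (hq : ‖q‖ < 1) : qPoch q q ≠ 0 := by
  rw [qPoch_self_eq]
  simp only [sub_eq_add_neg]
  refine tprod_one_add_ne_zero_of_summable (f := fun n : ℕ => -q ^ (n + 1)) (fun n => ?_) ?_
  · rw [← sub_eq_add_neg]
    exact one_sub_ne_zero_of_norm_lt (norm_pow_lt_one hq (Nat.succ_ne_zero n))
  · simpa using (summable_nat_add_iff 1).mpr (summable_geometric_of_lt_one (norm_nonneg _) hq)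

theorem qPoch_even_odd (hq : ‖q‖ < 1) :
    qPoch q q = qPoch q (q ^ 2) * qPoch (q ^ 2) (q ^ 2) := by
  have hq2 := norm_pow_lt_one hq two_ne_zero
  rw [qPoch, qPoch, qPoch, ← tprod_even_mul_odd (f := fun n : ℕ => 1 - q * q ^ n)]
  · congr 1 <;> refine tprod_congr fun n => ?_ <;> ring
  · exact (multipliable_qPoch q hq2).congr fun n => by ring
  · exact (multipliable_qPoch (q ^ 2) hq2).congr fun n => by ring

theorem qPoch_neg_mul (hq : ‖q‖ < 1) :
    qPoch q (q ^ 2) * qPoch (-q) (q ^ 2) = qPoch (q ^ 2) ((q ^ 2) ^ 2) := by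
  have hq2 := norm_pow_lt_one hq two_ne_zero
  rw [qPoch, qPoch, qPoch, ← (multipliable_qPoch q hq2).tprod_mul (multipliable_qPoch (-q) hq2)]
  exact tprod_congr fun n => by ring

theorem qPoch_neg_even_odd (hq : ‖q‖ < 1) :
    qPoch (-q) (-q) = qPoch (-q) (q ^ 2) * qPoch (q ^ 2) (q ^ 2) := by
  have := qPoch_even_odd (neg_norm_lt hq)
  rwa [neg_sq] at this

/-- Split each product by the parity of its index; (q;q²)(-q;q²) = (q²;q⁴) then pairs the odd parts.
This is what turns `thetaSq (-q)` into an eta quotient in q. -/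
theorem qPoch_neg_self (hq : ‖q‖ < 1) :
    qPoch (-q) (-q) * qPoch q q * qPoch (q ^ 4) (q ^ 4) = qPoch (q ^ 2) (q ^ 2) ^ 3 := by
  have h1 := qPoch_even_odd hq
  have h2 := qPoch_neg_even_odd hq
  have h3 := qPoch_neg_mul hq
  have h4 := qPoch_even_odd (norm_pow_lt_one hq two_ne_zero)
  rw [← pow_mul] at h3 h4
  rw [h1, h2]
  linear_combination qPoch (q ^ 2) (q ^ 2) ^ 2 * qPoch (q ^ 4) (q ^ 4) * h3 -
    qPoch (q ^ 2) (q ^ 2) ^ 2 * h4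

/-- The square of the theta function `θ₃`, as an eta quotient. -/
def thetaSq (q : ℂ) : ℂ :=
  qPoch (q ^ 2) (q ^ 2) ^ 10 / (qPoch q q ^ 4 * qPoch (q ^ 4) (q ^ 4) ^ 4)

theorem thetaSq_ne_zero (hq : ‖q‖ < 1) : thetaSq q ≠ 0 := by
  have h1 := qPoch_self_ne_zero hq
  have h2 := qPoch_self_ne_zero (norm_pow_lt_one hq two_ne_zero)
  have h4 := qPoch_self_ne_zero (norm_pow_lt_one hq four_ne_zero)
  rw [thetaSq]; positivity

theorem thetaSq_neg (hq : ‖q‖ < 1) :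
    thetaSq (-q) = qPoch q q ^ 4 / qPoch (q ^ 2) (q ^ 2) ^ 2 := by
  have h1 := qPoch_self_ne_zero hq
  have h1' := qPoch_self_ne_zero (neg_norm_lt hq)
  have h2 := qPoch_self_ne_zero (norm_pow_lt_one hq two_ne_zero)
  have h4 := qPoch_self_ne_zero (norm_pow_lt_one hq four_ne_zero)
  have h := qPoch_neg_self hq
  rw [thetaSq, neg_sq, Even.neg_pow (by decide : Even 4)]
  generalize qPoch (-q) (-q) = e' at *
  generalize qPoch q q = e1 at *
  generalize qPoch (q ^ 2) (q ^ 2) = e2 at *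
  generalize qPoch (q ^ 4) (q ^ 4) = e4 at *
  rw [div_eq_div_iff (by positivity) (by positivity),
    show e2 ^ 10 * e2 ^ 2 = (e2 ^ 3) ^ 4 by ring, ← h]
  ring

theorem differentiableOn_qPoch_pow {m : ℕ} (hm : m ≠ 0) :
    DifferentiableOn ℂ (fun q => qPoch (q ^ m) (q ^ m)) (Metric.ball (0 : ℂ) 1) :=
  differentiableOn_qPoch_self.comp (differentiable_pow m).differentiableOn fun q hq => by
    rw [mem_ball_zero_iff] at hq ⊢
    exact norm_pow_lt_one hq hm

theorem differentiableOn_thetaSq : DifferentiableOn ℂ thetaSq (Metric.ball (0 : ℂ) 1) := by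
  refine DifferentiableOn.div ((differentiableOn_qPoch_pow two_ne_zero).fun_pow 10)
    ((differentiableOn_qPoch_self.fun_pow 4).mul
      ((differentiableOn_qPoch_pow four_ne_zero).fun_pow 4)) fun q hq => ?_
  rw [mem_ball_zero_iff] at hq
  have h1 := qPoch_self_ne_zero hq
  have h4 := qPoch_self_ne_zero (norm_pow_lt_one hq four_ne_zero)
  exact mul_ne_zero (pow_ne_zero 4 h1) (pow_ne_zero 4 h4)

theorem thetaSq_zero : thetaSq 0 = 1 := by
  simp [thetaSq, qPoch_self_zero]

end Products

/-! ### The mean iteration q ↦ q² and the ratio W(π)/W(0) -/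

section WeightOne

variable {q : ℂ}

theorem coshCoeff_neg_base (n : ℤ) :
    coshCoeff (-q) n = (if Odd n then -1 else 1) * coshCoeff q n := by
  rw [coshCoeff, coshCoeff]
  by_cases h : Odd n
  · rw [h.neg_zpow, if_pos h]; ring
  · rw [(Int.not_odd_iff_even.mp h).neg_zpow, if_neg h]; ring

theorem jacW_neg_zero (q : ℂ) : jacW (-q) 0 = jacW q Real.pi := by
  rw [jacW, fser_zero, jacW, ← zero_add Real.pi, fser_add_pi]
  simp [coshCoeff_neg_base]

theorem tsum_int_even (f : ℤ → ℂ) :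
    ∑' n : ℤ, (if Even n then f n else 0) = ∑' n : ℤ, f (2 * n) := by
  have hi : Function.Injective fun n : ℤ => 2 * n := fun a b h => by simpa using h
  rw [← hi.tsum_eq]
  · exact tsum_congr fun n => if_pos (even_two_mul n)
  · intro n hn
    rw [Function.mem_support] at hn
    have : Even n := by by_contra h; exact hn (if_neg h)
    obtain ⟨m, hm⟩ := this
    exact ⟨m, by simp [hm]; ring⟩

theorem coshCoeff_sq (n : ℤ) : coshCoeff q (2 * n) = coshCoeff (q ^ 2) n := by
  have : q ^ (2 * n) = (q ^ 2) ^ n := by rw [zpow_mul]; norm_cast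
  rw [coshCoeff, coshCoeff, this]

/-- The arithmetic half of the mean step: averaging over the shift by π keeps the even frequencies,
whose coefficients are those for q². -/
theorem jacW_sq_zero (hq0 : q ≠ 0) (hq : ‖q‖ < 1) :
    jacW (q ^ 2) 0 = (jacW q 0 + jacW q Real.pi) / 2 := by
  have h := (rapid_coshCoeff hq0 hq).fser_add_fser_add_pi 0
  rw [zero_add, fser_zero _, fser_zero, tsum_int_even] at h
  have h2 : jacW (q ^ 2) 0 = ∑' n : ℤ, coshCoeff q (2 * n) := by
    rw [jacW, fser_zero]
    exact tsum_congr fun n => (coshCoeff_sq n).symm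
  rw [h2, jacW, fser_zero, jacW]
  linear_combination -1 / 2 * h

theorem fser_of_even {a : ℤ → ℂ} (h : ∀ n, a (-n) = a n) (u : ℝ) : fser a (-u) = fser a u := by
  rw [fser, fser, ← (Equiv.neg ℤ).tsum_eq]
  refine tsum_congr fun n => ?_
  rw [Equiv.neg_apply, h]
  push_cast
  ring_nf

theorem cexp_half_pi (n : ℤ) :
    cexp (I * ((2 * n : ℤ) : ℂ) * ((Real.pi / 2 : ℝ) : ℂ)) = if Odd n then -1 else 1 := by
  have := cexp_I_int_add_pi n 0
  simp only [zero_add, Complex.ofReal_zero, mul_zero, Complex.exp_zero, mul_one] at this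
  rw [← this]
  congr 1
  push_cast; ring

/-- W is even and 2π-periodic, so its values at π/2 and 3π/2 agree. Hence each equals their average,
which only involves even frequencies. -/
theorem jacW_half_pi (hq0 : q ≠ 0) (hq : ‖q‖ < 1) :
    jacW q (Real.pi / 2) = jacW (q ^ 2) Real.pi ∧
      jacW q (Real.pi / 2 + Real.pi) = jacW (q ^ 2) Real.pi := by
  have hc := rapid_coshCoeff hq0 hq
  have hper : jacW q (Real.pi / 2 + Real.pi) = jacW q (Real.pi / 2) := by
    have h1 : jacW q (Real.pi / 2) = jacW q (-(Real.pi / 2)) :=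
      (fser_of_even (coshCoeff_neg hq0) (Real.pi / 2)).symm
    rw [h1, jacW, jacW,
      show Real.pi / 2 + Real.pi = (-(Real.pi / 2) + Real.pi) + Real.pi by ring, fser_add_pi, fser]
    refine tsum_congr fun n => ?_
    rw [cexp_I_int_add_pi]
    split_ifs <;> ring
  rw [hper, and_self]
  have h := hc.fser_add_fser_add_pi (Real.pi / 2)
  have e : fser (fun n => if Even n then coshCoeff q n else 0) (Real.pi / 2) =
      ∑' n : ℤ, (if Even n then
        coshCoeff q n * cexp (I * n * ((Real.pi / 2 : ℝ) : ℂ)) else 0) := by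
    rw [fser]
    refine tsum_congr fun n => ?_
    split_ifs <;> simp
  rw [e, tsum_int_even] at h
  have h2 : jacW (q ^ 2) Real.pi = ∑' n : ℤ,
      coshCoeff q (2 * n) * cexp (I * ((2 * n : ℤ) : ℂ) * ((Real.pi / 2 : ℝ) : ℂ)) := by
    rw [← jacW_neg_zero, jacW, fser_zero]
    refine tsum_congr fun n => ?_
    rw [coshCoeff_neg_base, coshCoeff_sq, cexp_half_pi]; ring
  rw [← h2] at h
  change jacW q _ + jacW q _ = _ at h
  rw [hper] at h
  linear_combination 1 / 2 * h

/-- The geometric half of the mean step: the constant product W(u)W(u+π) is compared at u = 0 and u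
= π/2. -/
theorem jacW_sq_pi (hq0 : q ≠ 0) (hq : ‖q‖ < 1) :
    jacW (q ^ 2) Real.pi ^ 2 = jacW q 0 * jacW q Real.pi := by
  rw [← jacW_mul_jacW_add_pi hq0 hq (Real.pi / 2), (jacW_half_pi hq0 hq).1,
    (jacW_half_pi hq0 hq).2, sq]

/-- The logarithmic derivative of `jacW`, integrated from `0` to `π`. -/
theorem jacW_pi_eq_mul_exp (hq0 : q ≠ 0) (hq : ‖q‖ < 1) :
    jacW q Real.pi = jacW q 0 * cexp (-2 * ∑' n : ℤ, 2 * oddSinhCoeff q n / n) := by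
  set p : ℤ → ℂ := fun n => 2 * oddSinhCoeff q n / n with hp
  have hs := rapid_oddSinhCoeff hq0 hq
  have hpR : Rapid p := by
    refine (hs.const_mul 2).of_norm_le fun n => ?_
    rw [hp, norm_div]
    rcases eq_or_ne n 0 with rfl | hn
    · simp
    · refine div_le_self (norm_nonneg _) ?_
      rw [Complex.norm_intCast]
      exact_mod_cast Int.one_le_abs hn
  have hd : ∀ u, HasDerivAt (fser p) (2 * I * jacS q u) u := by
    intro u
    refine (hpR.hasDerivAt_fser u).congr_deriv ?_
    have : (fun n : ℤ => (n : ℂ) * p n) = fun n => 2 * oddSinhCoeff q n := by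
      funext n
      rcases eq_or_ne n 0 with rfl | hn
      · simp [oddSinhCoeff]
      · have : (n : ℂ) ≠ 0 := by exact_mod_cast hn
        simp only [hp]; field_simp
    rw [this, fser_const_mul, jacS]; ring
  have hc := eq_of_hasDerivAt_zero (f := fun u => jacW q u * cexp (-fser p u)) (fun u =>
    ((hasDerivAt_jacW hq0 hq u).mul (hd u).neg.cexp).congr_deriv (by ring)) Real.pi 0
  have h0 : fser p 0 = ∑' n, p n := fser_zero p
  -- The antiderivative has only odd frequencies, so its value at π is minus its value at 0; this
  -- produces the factor -2 in the exponent.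
  have hpi : fser p Real.pi = -∑' n, p n := by
    rw [← zero_add Real.pi, fser_add_pi, ← tsum_neg]
    refine tsum_congr fun n => ?_
    by_cases hn : Odd n <;> simp [hp, oddSinhCoeff, hn]
  simp only [h0, hpi, neg_neg] at hc
  have h3 : jacW q Real.pi = jacW q Real.pi * cexp (∑' n, p n) * cexp (-∑' n, p n) := by
    rw [mul_assoc, ← Complex.exp_add, add_neg_cancel, Complex.exp_zero, mul_one]
  rw [h3, hc, mul_assoc, ← Complex.exp_add]
  congr 2; ring

theorem hasSum_artanh {x : ℂ} (hx : ‖x‖ < 1) :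
    HasSum (fun m : ℕ => 2 * x ^ (2 * m + 1) / (2 * m + 1 : ℕ)) (log (1 + x) - log (1 - x)) := by
  have h1 := hasSum_taylorSeries_neg_log hx
  have h2 := hasSum_taylorSeries_neg_log (neg_norm_lt hx)
  have h3 := h1.sub h2
  have hi : Function.Injective fun m : ℕ => 2 * m + 1 := fun a b h => by simpa using h
  have h4 := (hi.hasSum_iff (f := fun n : ℕ => x ^ n / n - (-x) ^ n / n) (fun n hn => ?_)).mpr h3
  · rw [sub_neg_eq_add 1 x] at h4
    rw [show log (1 + x) - log (1 - x) = -log (1 - x) - -log (1 + x) by ring]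
    refine h4.congr_fun fun m => ?_
    simp only [Function.comp, Odd.neg_pow (odd_two_mul_add_one m)]
    ring
  · have : Even n := by
      by_contra h
      obtain ⟨m, hm⟩ := Nat.not_even_iff_odd.mp h
      exact hn ⟨m, hm.symm⟩
    rw [this.neg_pow, sub_self]

/-- Expand `sinhCoeff` geometrically and interchange the two summations. The inner sums become
artanh series, so the exponential in `jacW_pi_eq_mul_exp` is an infinite product. -/
theorem hasSum_log_div_log (hq0 : q ≠ 0) (hq : ‖q‖ < 1) :
    HasSum (fun n : ℕ => 2 * (log (1 + q ^ (2 * n + 1)) - log (1 - q ^ (2 * n + 1))))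
      (∑' n : ℤ, 2 * oddSinhCoeff q n / n) := by
  have hs : Summable fun n : ℤ => 2 * oddSinhCoeff q n / n := by
    refine Summable.of_norm (((rapid_oddSinhCoeff hq0 hq).const_mul 2).summable_norm.of_nonneg_of_le
      (fun _ => norm_nonneg _) fun n => ?_)
    rw [norm_div]
    rcases eq_or_ne n 0 with rfl | hn
    · simp
    · refine div_le_self (norm_nonneg _) ?_
      rw [Complex.norm_intCast]
      exact_mod_cast Int.one_le_abs hn
  have hi : Function.Injective fun m : ℕ => 2 * m + 1 := fun a b h => by simpa using h
  have h1 : ∑' n : ℤ, 2 * oddSinhCoeff q n / n =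
      ∑' m : ℕ, 4 * sinhCoeff q (2 * m + 1 : ℕ) / (2 * m + 1 : ℕ) := by
    rw [tsum_int_of_even hs (by simp) fun n => by
      rw [oddSinhCoeff_neg hq0]; push_cast; rw [mul_neg, neg_div_neg_eq], ← tsum_mul_left,
      ← hi.tsum_eq]
    · refine tsum_congr fun m => ?_
      rw [oddSinhCoeff, if_pos (by push_cast; exact odd_two_mul_add_one _)]
      push_cast; ring
    · intro n hn
      rw [Function.mem_support] at hn
      have : Odd (n : ℤ) := by
        by_contra h
        exact hn (by simp [oddSinhCoeff, h])
      obtain ⟨m, hm⟩ := (Int.odd_coe_nat n).mp this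
      exact ⟨m, hm.symm⟩
  have h2 : Summable fun x : ℕ × ℕ =>
      4 * q ^ ((2 * x.1 + 1) * (2 * x.2 + 1)) / (2 * x.2 + 1 : ℕ) := by
    have h := (summable_lambert hq 0).comp_injective (i := Prod.map id fun m => 2 * m + 1)
      (Function.Injective.prodMap Function.injective_id hi)
    refine Summable.of_norm ((h.norm.mul_left 4).of_nonneg_of_le (fun _ => norm_nonneg _)
      fun x => ?_)
    have h1 : (1 : ℝ) ≤ ((2 * x.2 + 1 : ℕ) : ℝ) := by exact_mod_cast Nat.succ_pos _
    simp only [Function.comp, Prod.map, id, norm_div, norm_mul, zero_add, pow_one,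
      Complex.norm_natCast, Complex.norm_ofNat]
    refine (div_le_self (by positivity) h1).trans ?_
    gcongr
    exact le_mul_of_one_le_left (norm_nonneg _) h1
  have h3 : ∀ n : ℕ, HasSum
      (fun m : ℕ => 4 * q ^ ((2 * n + 1) * (2 * m + 1)) / (2 * m + 1 : ℕ))
      (2 * (log (1 + q ^ (2 * n + 1)) - log (1 - q ^ (2 * n + 1)))) := by
    intro n
    refine ((hasSum_artanh (norm_pow_lt_one hq (show 2 * n + 1 ≠ 0 by lia))).mul_left 2).congr_fun
      fun m => ?_
    rw [← pow_mul]; ring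
  have h4 : ∀ m : ℕ, ∑' n : ℕ, 4 * q ^ ((2 * n + 1) * (2 * m + 1)) / ((2 * m + 1 : ℕ) : ℂ) =
      4 * sinhCoeff q (2 * m + 1 : ℕ) / (2 * m + 1 : ℕ) := by
    intro m
    have h := tsum_lambert hq 0 (2 * m + 1)
    have h0 : ((2 * m + 1 : ℕ) : ℂ) ≠ 0 := Nat.cast_ne_zero.mpr (Nat.succ_ne_zero _)
    simp only [zero_add, pow_one] at h
    rw [tsum_mul_left] at h
    have h6 := mul_left_cancel₀ h0 h
    rw [tsum_div_const, tsum_mul_left, h6]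
  have h5 : ∑' x : ℕ × ℕ, 4 * q ^ ((2 * x.1 + 1) * (2 * x.2 + 1)) / ((2 * x.2 + 1 : ℕ) : ℂ) =
      ∑' n : ℤ, 2 * oddSinhCoeff q n / n := by
    rw [h1, ← tsum_congr h4, h2.tsum_prod]
    exact (Summable.tsum_comm
      (f := fun n m : ℕ => 4 * q ^ ((2 * n + 1) * (2 * m + 1)) / ((2 * m + 1 : ℕ) : ℂ)) h2).symm
  rw [← h5]
  exact h2.hasSum.prod_fiberwise h3

theorem jacW_pi_mul (hq0 : q ≠ 0) (hq : ‖q‖ < 1) :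
    jacW q Real.pi * qPoch (-q) (-q) ^ 4 = jacW q 0 * qPoch q q ^ 4 := by
  have h := ((hasSum_log_div_log hq0 hq).mul_left (-2)).cexp
  have hq2 := norm_pow_lt_one hq two_ne_zero
  have h1 := (multipliable_qPoch q hq2).hasProd
  have h2 := (multipliable_qPoch (-q) hq2).hasProd
  have h3 := h.mul (h2.pow 4)
  have h4 : cexp (-2 * ∑' n : ℤ, 2 * oddSinhCoeff q n / n) * qPoch (-q) (q ^ 2) ^ 4 =
      qPoch q (q ^ 2) ^ 4 := by
    refine h3.unique ((h1.pow 4).congr_fun fun n => ?_)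
    have hx : ‖q ^ (2 * n + 1)‖ < 1 := norm_pow_lt_one hq (by lia)
    have e1 := one_sub_ne_zero_of_norm_lt hx
    have e2 : 1 + q ^ (2 * n + 1) ≠ 0 := by
      have := one_sub_ne_zero_of_norm_lt (neg_norm_lt hx)
      rwa [sub_neg_eq_add] at this
    simp only [Function.comp]
    rw [show q * (q ^ 2) ^ n = q ^ (2 * n + 1) by ring,
      show -q * (q ^ 2) ^ n = -q ^ (2 * n + 1) by ring,
      show -2 * (2 * (log (1 + q ^ (2 * n + 1)) - log (1 - q ^ (2 * n + 1)))) =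
        4 * log (1 - q ^ (2 * n + 1)) - 4 * log (1 + q ^ (2 * n + 1)) by ring,
      Complex.exp_sub, show (4 : ℂ) = (4 : ℕ) by norm_num, Complex.exp_nat_mul,
      Complex.exp_nat_mul, Complex.exp_log e1, Complex.exp_log e2, sub_neg_eq_add]
    field_simp
  rw [jacW_pi_eq_mul_exp hq0 hq, qPoch_neg_even_odd hq, qPoch_even_odd hq, mul_pow, mul_pow, ← h4]
  ring

end WeightOne

/-! ### Identification of T and F with eta quotients -/

section Identification

variable {q : ℂ}

theorem tendsto_jacW_zero : Tendsto (fun q => jacW q 0) (𝓝[≠] 0) (𝓝 (1 / 2)) := by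
  have hb : Summable fun n : ℤ => ‖((2 * (1 / 2) ^ n.natAbs : ℝ) : ℂ)‖ := by
    refine (rapid_of_geometric (a := fun n : ℤ => ((2 * (1 / 2) ^ n.natAbs : ℝ) : ℂ))
      (K := 2) (r := 1 / 2) (by norm_num) (by norm_num) fun n => ?_).summable_norm
    rw [Complex.norm_real, Real.norm_of_nonneg (by positivity)]
  have hsmall : ∀ᶠ q : ℂ in 𝓝[≠] 0, ∀ n : ℤ, ‖coshCoeff q n‖ ≤ 2 * ‖q‖ ^ n.natAbs := by
    have h1 : ∀ᶠ q : ℂ in 𝓝[≠] 0, ‖q‖ < 1 / 2 :=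
      (Metric.eventually_nhds_iff.mpr
        ⟨1 / 2, by norm_num, fun y hy => by simpa using hy⟩).filter_mono nhdsWithin_le_nhds
    filter_upwards [h1, self_mem_nhdsWithin] with q hq hq0 n
    refine (norm_coshCoeff_le hq0 (hq.trans (by norm_num)) n).trans ?_
    gcongr
    rw [inv_le_comm₀ (by linarith) two_pos]
    linarith
  have h := tendsto_tsum_of_dominated_convergence (f := fun q n => coshCoeff q n)
    (g := fun n : ℤ => if n = 0 then (1 / 2 : ℂ) else 0) (𝓕 := 𝓝[≠] 0) hb (fun n => ?_) ?_
  · simpa [jacW, fser_zero] using h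
  · rcases eq_or_ne n 0 with rfl | hn
    · simp only [coshCoeff, zpow_zero, if_pos]
      norm_num
    · rw [if_neg hn]
      have h0 : Tendsto (fun q : ℂ => 2 * ‖q‖ ^ n.natAbs) (𝓝[≠] 0) (𝓝 0) := by
        have : Tendsto (fun q : ℂ => 2 * ‖q‖ ^ n.natAbs) (𝓝 0) (𝓝 (2 * ‖(0 : ℂ)‖ ^ n.natAbs)) :=
          (continuous_const.mul (continuous_norm.pow _)).tendsto 0
        rw [norm_zero, zero_pow (by simpa using hn), mul_zero] at this
        exact this.mono_left nhdsWithin_le_nhds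
      exact squeeze_zero_norm' (hsmall.mono fun q hq => hq n) h0
  · have h1 : ∀ᶠ q : ℂ in 𝓝[≠] 0, ‖q‖ < 1 / 2 :=
      (Metric.eventually_nhds_iff.mpr
        ⟨1 / 2, by norm_num, fun y hy => by simpa using hy⟩).filter_mono nhdsWithin_le_nhds
    filter_upwards [hsmall, h1] with q hq hq1 n
    rw [Complex.norm_real, Real.norm_of_nonneg (by positivity)]
    refine (hq n).trans ?_
    gcongr

theorem thetaSq_neg_sq (hq : ‖q‖ < 1) :
    thetaSq (-q ^ 2) ^ 2 = thetaSq q * thetaSq (-q) := by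
  have h2 := qPoch_self_ne_zero (norm_pow_lt_one hq two_ne_zero)
  have h1 := qPoch_self_ne_zero hq
  have h4 := qPoch_self_ne_zero (norm_pow_lt_one hq four_ne_zero)
  rw [thetaSq_neg (norm_pow_lt_one hq two_ne_zero), thetaSq_neg hq, thetaSq, ← pow_mul]
  field_simp

theorem jacW_pi_mul_thetaSq (hq0 : q ≠ 0) (hq : ‖q‖ < 1) :
    jacW q Real.pi * thetaSq q = jacW q 0 * thetaSq (-q) := by
  have h2 := qPoch_self_ne_zero (norm_pow_lt_one hq two_ne_zero)
  have h := thetaSq_neg (neg_norm_lt hq)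
  rw [neg_neg, neg_sq] at h
  rw [h, thetaSq_neg hq, mul_div_assoc', jacW_pi_mul hq0 hq, mul_div_assoc]

theorem tendsto_pow_two_pow (hq0 : q ≠ 0) (hq : ‖q‖ < 1) :
    Tendsto (fun n : ℕ => q ^ 2 ^ n) atTop (𝓝[≠] 0) := by
  refine tendsto_nhdsWithin_iff.mpr ⟨(tendsto_pow_atTop_nhds_zero_of_norm_lt_one hq).comp
    (tendsto_pow_atTop_atTop_of_one_lt one_lt_two), ?_⟩
  exact Eventually.of_forall fun n => pow_ne_zero _ hq0

/-- Iterating `q ↦ q²` moves every point of the unit disc towards `0`. -/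
theorem eq_of_comp_sq {f : ℂ → ℂ} {c : ℂ} (h : ∀ q, q ≠ 0 → ‖q‖ < 1 → f (q ^ 2) = f q)
    (hc : Tendsto f (𝓝[≠] 0) (𝓝 c)) (hq0 : q ≠ 0) (hq : ‖q‖ < 1) : f q = c := by
  have h1 : ∀ n : ℕ, f (q ^ 2 ^ n) = f q := by
    intro n
    induction n with
    | zero => simp
    | succ n ih =>
      rw [pow_succ, pow_mul, h _ (pow_ne_zero _ hq0) (norm_pow_lt_one hq (by positivity)), ih]
  exact tendsto_nhds_unique (tendsto_const_nhds.congr fun n => (h1 n).symm)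
    (hc.comp (tendsto_pow_two_pow hq0 hq))

/-- W(0)/θ₃² equals W(π)/θ₄², and both numerators and denominators obey the geometric mean rule. The
squared ratio is therefore invariant under q ↦ q² and equals its limit at 0. The square is forced
because the rule determines only W(q²,π)². -/
theorem jacW_zero_sq_eq (hq0 : q ≠ 0) (hq : ‖q‖ < 1) :
    (jacW q 0 / thetaSq q) ^ 2 = (1 / 2) ^ 2 := by
  refine eq_of_comp_sq (f := fun q => (jacW q 0 / thetaSq q) ^ 2) (fun q hq0 hq => ?_) ?_ hq0 hq
  · have hq2 := norm_pow_lt_one hq two_ne_zero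
    have n1 := thetaSq_ne_zero hq
    have n2 := thetaSq_ne_zero (neg_norm_lt hq)
    have n3 := thetaSq_ne_zero hq2
    have n4 := thetaSq_ne_zero (neg_norm_lt hq2)
    have e1 := jacW_pi_mul_thetaSq hq0 hq
    have e2 := jacW_pi_mul_thetaSq (pow_ne_zero 2 hq0) hq2
    have e3 := jacW_sq_pi hq0 hq
    have e4 := thetaSq_neg_sq hq
    have e5 : jacW (q ^ 2) 0 / thetaSq (q ^ 2) = jacW (q ^ 2) Real.pi / thetaSq (-q ^ 2) := by
      rw [div_eq_div_iff n3 n4, e2]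
    have e6 : jacW q Real.pi = jacW q 0 * thetaSq (-q) / thetaSq q := by
      rw [eq_div_iff n1, e1]
    rw [e5, div_pow, e3, e4, e6]
    field_simp
  · have hθ : Tendsto thetaSq (𝓝[≠] 0) (𝓝 1) := by
      have := (differentiableOn_thetaSq.continuousOn.continuousAt
        (Metric.ball_mem_nhds 0 one_pos)).tendsto
      rw [thetaSq_zero] at this
      exact this.mono_left nhdsWithin_le_nhds
    simpa using (tendsto_jacW_zero.div hθ one_ne_zero).pow 2

theorem formT_eq (hq0 : q ≠ 0) (hq : ‖q‖ < 1) : formT q = thetaSq q ^ 2 := by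
  have h := jacW_zero_sq_eq hq0 hq
  have n1 := thetaSq_ne_zero hq
  rw [div_pow, div_eq_iff (pow_ne_zero 2 n1)] at h
  rw [formT, h]; ring

theorem formF_eq_sub (hq0 : q ≠ 0) (hq : ‖q‖ < 1) :
    formF q = (thetaSq q ^ 2 - thetaSq (-q) ^ 2) / 16 := by
  rw [← formT_eq hq0 hq, ← formT_eq (neg_ne_zero.mpr hq0) (neg_norm_lt hq), formT, formT,
    jacW_neg_zero, formF]
  ring

/-- From the mean step, with w = W(0) and v = W(π): F(q²) = (w - v)²/16 and T(q²) = (w + v)². -/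
theorem formF_sq (hq0 : q ≠ 0) (hq : ‖q‖ < 1) :
    formF q ^ 2 = formF (q ^ 2) * formT (q ^ 2) := by
  rw [formF, formF, formT, jacW_sq_pi hq0 hq, jacW_sq_zero hq0 hq]
  ring

/-- `q (q⁴;q⁴)⁸ / (q²;q²)⁴` without the factor `q`. -/
def etaQuot (q : ℂ) : ℂ := qPoch (q ^ 4) (q ^ 4) ^ 8 / qPoch (q ^ 2) (q ^ 2) ^ 4

theorem etaQuot_ne_zero (hq : ‖q‖ < 1) : etaQuot q ≠ 0 := by
  have h2 := qPoch_self_ne_zero (norm_pow_lt_one hq two_ne_zero)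
  have h4 := qPoch_self_ne_zero (norm_pow_lt_one hq four_ne_zero)
  rw [etaQuot]; positivity

theorem etaQuot_sq (hq : ‖q‖ < 1) :
    etaQuot q ^ 2 = etaQuot (q ^ 2) * thetaSq (q ^ 2) ^ 2 := by
  have h2 := qPoch_self_ne_zero (norm_pow_lt_one hq two_ne_zero)
  have h4 := qPoch_self_ne_zero (norm_pow_lt_one hq four_ne_zero)
  have h8 := qPoch_self_ne_zero (norm_pow_lt_one hq (show 8 ≠ 0 by norm_num))
  rw [etaQuot, etaQuot, thetaSq]
  simp only [← pow_mul]
  norm_num only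
  field_simp

theorem differentiableOn_etaQuot : DifferentiableOn ℂ etaQuot (Metric.ball (0 : ℂ) 1) := by
  refine DifferentiableOn.div ((differentiableOn_qPoch_pow four_ne_zero).fun_pow 8)
    ((differentiableOn_qPoch_pow two_ne_zero).fun_pow 4) fun q hq => ?_
  rw [mem_ball_zero_iff] at hq
  exact pow_ne_zero 4 (qPoch_self_ne_zero (norm_pow_lt_one hq two_ne_zero))

/-- For k = 1 the expansion of `G` reduces to F, which is thus a Lambert series with nonnegative
terms; its first term is at least x. The bound serves to exclude a double zero of F at q = 0. -/
theorem le_norm_formF {x : ℝ} (hx0 : 0 < x) (hx : x < 1) : x ≤ ‖formF x‖ := by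
  have hx0' : (x : ℂ) ≠ 0 := by exact_mod_cast hx0.ne'
  have hx' : ‖(x : ℂ)‖ < 1 := by rwa [Complex.norm_real, Real.norm_of_nonneg hx0.le]
  obtain ⟨α, hα⟩ := exists_G_eq_sum one_pos
  have hZ : Z 1 = 1 := by
    rw [Z, mul_one, bernoulli_two]; norm_num
  have h1 : formF x = G 1 x := by rw [hα x hx0' hx']; simp [hZ]
  have h2 := G_of_odd hx' (j := 0) (by decide)
  rw [zero_add] at h2
  set f : ℕ → ℝ := fun m => (2 * m + 1) * (x ^ (2 * m + 1) / (1 - (x ^ (2 * m + 1)) ^ 2)) with hf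
  have hf0 : ∀ m, 0 ≤ f m := by
    intro m
    have : (x ^ (2 * m + 1)) ^ 2 ≤ 1 :=
      pow_le_one₀ (by positivity) (pow_le_one₀ hx0.le hx.le)
    exact mul_nonneg (by positivity) (div_nonneg (by positivity) (by linarith))
  have h3 : ∀ m : ℕ, ((2 * m + 1 : ℕ) : ℂ) ^ (2 * 0 + 1) * sinhCoeff x (2 * m + 1 : ℕ) =
      (f m : ℂ) := by
    intro m
    simp only [hf, sinhCoeff, zpow_natCast]
    push_cast; ring
  rw [tsum_congr h3, ← Complex.ofReal_tsum] at h2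
  have h4 : Summable f := by
    have hs := ((rapid_sinhCoeff hx0' hx').int_mul).summable
    have hi : Function.Injective fun m : ℕ => ((2 * m + 1 : ℕ) : ℤ) := fun a b h => by
      simpa using h
    refine Complex.summable_ofReal.mp ((hs.comp_injective hi).congr fun m => ?_)
    rw [← h3]
    simp only [Function.comp]
    push_cast; ring
  rw [h1, h2, Complex.norm_real, Real.norm_of_nonneg (tsum_nonneg hf0)]
  refine le_trans ?_ (h4.le_tsum 0 fun m _ => hf0 m)
  simp only [hf]
  norm_num
  rw [le_div_iff₀ (by nlinarith)]
  nlinarith [pow_pos hx0 3]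

/-- F² and (q · `etaQuot q`)² obey the same duplication rule, so their ratio ρ is holomorphic on the
disc with ρ(q²) = ρ(q)². Together with ρ(0) ≠ 0 this forces ρ = 1. -/
theorem formF_eq (hq0 : q ≠ 0) (hq : ‖q‖ < 1) : formF q = q * etaQuot q := by
  set B := Metric.ball (0 : ℂ) 1 with hB
  have hB0 : B ∈ 𝓝 (0 : ℂ) := Metric.ball_mem_nhds 0 one_pos
  set H : ℂ → ℂ := fun q => (thetaSq q ^ 2 - thetaSq (-q) ^ 2) / 16 with hH
  have hHd : DifferentiableOn ℂ H B := by
    refine ((differentiableOn_thetaSq.fun_pow 2).sub (DifferentiableOn.fun_pow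
      (differentiableOn_thetaSq.comp differentiable_neg.differentiableOn
        fun q hq => ?_) 2)).div_const 16
    rw [mem_ball_zero_iff] at hq ⊢
    exact neg_norm_lt hq
  -- H vanishes at 0, so `dslope H 0` is the holomorphic extension of H(q)/q across 0.
  set ρ : ℂ → ℂ := fun q => dslope H 0 q / etaQuot q with hρ
  have hρd : DifferentiableOn ℂ ρ B :=
    ((Complex.differentiableOn_dslope hB0).mpr hHd).div differentiableOn_etaQuot fun q hq =>
      etaQuot_ne_zero (by rwa [hB, mem_ball_zero_iff] at hq)
  have hρeq : ∀ q, q ≠ 0 → ‖q‖ < 1 → ρ q * (q * etaQuot q) = formF q := by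
    intro q hq0 hq
    have := etaQuot_ne_zero hq
    rw [formF_eq_sub hq0 hq, hρ]
    simp only [dslope_of_ne H hq0, slope_def_field]
    simp only [hH]
    simp only [neg_zero, sub_self, zero_div, sub_zero]
    field_simp
  have hρsq : ∀ q, q ≠ 0 → ‖q‖ < 1 → ρ (q ^ 2) = ρ q ^ 2 := by
    intro q hq0 hq
    have hq2 := norm_pow_lt_one hq two_ne_zero
    have n1 := etaQuot_ne_zero hq2
    have n2 := thetaSq_ne_zero hq2
    have h := formF_sq hq0 hq
    rw [← hρeq q hq0 hq, ← hρeq _ (pow_ne_zero 2 hq0) hq2, formT_eq (pow_ne_zero 2 hq0) hq2,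
      mul_pow, mul_pow, etaQuot_sq hq] at h
    refine mul_right_cancel₀ (b := q ^ 2 * (etaQuot (q ^ 2) * thetaSq (q ^ 2) ^ 2)) ?_ ?_
    · positivity
    · rw [h]; ring
  have hcont : ContinuousAt ρ 0 := hρd.continuousOn.continuousAt hB0
  have hz : ρ 0 ^ 2 = ρ 0 := by
    have t1 : Tendsto (fun q => ρ q ^ 2) (𝓝[≠] 0) (𝓝 (ρ 0 ^ 2)) :=
      (hcont.tendsto.mono_left nhdsWithin_le_nhds).pow 2
    have t2 : Tendsto (fun q : ℂ => ρ (q ^ 2)) (𝓝[≠] 0) (𝓝 (ρ 0)) := by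
      have : Tendsto (fun q : ℂ => q ^ 2) (𝓝 0) (𝓝 0) := by
        simpa using (continuous_pow 2 (M := ℂ)).tendsto 0
      exact (hcont.tendsto.comp this).mono_left nhdsWithin_le_nhds
    refine tendsto_nhds_unique t1 (t2.congr' ?_)
    have h1 : ∀ᶠ q : ℂ in 𝓝[≠] 0, q ∈ B := nhdsWithin_le_nhds hB0
    filter_upwards [h1, self_mem_nhdsWithin] with q hq hq0
    exact hρsq q hq0 (by rwa [hB, mem_ball_zero_iff] at hq)
  have hz1 : ρ 0 = 1 := by
    rcases eq_or_ne (ρ 0) 0 with h0 | h0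
    · exfalso
      have hM : ContinuousAt etaQuot 0 := differentiableOn_etaQuot.continuousOn.continuousAt hB0
      have t1 : Tendsto (fun x : ℝ => ‖ρ x * etaQuot x‖) (𝓝[>] 0) (𝓝 0) := by
        have h2 : Tendsto (fun x : ℝ => (x : ℂ)) (𝓝[>] 0) (𝓝 0) := by
          have := Complex.continuous_ofReal.tendsto 0
          rw [Complex.ofReal_zero] at this
          exact this.mono_left nhdsWithin_le_nhds
        have := ((hcont.tendsto.comp h2).mul (hM.tendsto.comp h2)).norm
        simpa [h0] using this
      have t2 : ∀ᶠ x : ℝ in 𝓝[>] 0, (1 : ℝ) ≤ ‖ρ x * etaQuot x‖ := by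
        filter_upwards [Ioo_mem_nhdsGT one_pos] with x hx
        have hx0 : (x : ℂ) ≠ 0 := by exact_mod_cast hx.1.ne'
        have hxn : ‖(x : ℂ)‖ = x := by rw [Complex.norm_real, Real.norm_of_nonneg hx.1.le]
        have h3 := le_norm_formF hx.1 hx.2
        rw [← hρeq x hx0 (by rw [hxn]; exact hx.2), mul_left_comm, norm_mul, hxn] at h3
        exact le_of_mul_le_mul_left (by linarith) hx.1
      have := ge_of_tendsto t1 t2
      linarith
    · exact mul_right_cancel₀ h0 (by rw [one_mul, ← sq, hz])
  -- The values ρ(q)^{2^n} = ρ(q^{2^n}) converge to ρ(0), which is impossible if |ρ(q)| > 1. So |ρ|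
  -- is maximal at 0 and the maximum principle applies.
  have hle : ∀ q ∈ B, ‖ρ q‖ ≤ ‖ρ 0‖ := by
    intro q hqB
    rw [hB, mem_ball_zero_iff] at hqB
    rcases eq_or_ne q 0 with rfl | hq0
    · exact le_rfl
    · have h1 : ∀ n : ℕ, ρ (q ^ 2 ^ n) = ρ q ^ 2 ^ n := by
        intro n
        induction n with
        | zero => simp
        | succ n ih =>
          rw [pow_succ, pow_mul, hρsq _ (pow_ne_zero _ hq0) (norm_pow_lt_one hqB (by positivity)),
            ih, pow_mul]
      have h2 := (hcont.tendsto.mono_left nhdsWithin_le_nhds).comp (tendsto_pow_two_pow hq0 hqB)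
      have h3 := h2.norm
      rw [hz1, norm_one]
      by_contra! hlt
      have h4 : Tendsto (fun n : ℕ => ‖ρ q‖ ^ 2 ^ n) atTop atTop :=
        (tendsto_pow_atTop_atTop_of_one_lt hlt).comp (tendsto_pow_atTop_atTop_of_one_lt one_lt_two)
      refine not_tendsto_nhds_of_tendsto_atTop (h4.congr fun n => ?_) _ h3
      rw [Function.comp, h1, norm_pow]
  have hconst := Complex.eqOn_of_isPreconnected_of_isMaxOn_norm
    (convex_ball (0 : ℂ) 1).isPreconnected Metric.isOpen_ball hρd
    (Metric.mem_ball_self one_pos) (fun q hq => hle q hq)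
  have := hconst (mem_ball_zero_iff.mpr hq)
  rw [Function.const, hz1] at this
  rw [← hρeq q hq0 hq, this, one_mul]

end Identification

/-! ### Inversion of the Dedekind eta function -/

section EtaInversion

theorem eta_eq_qPoch (z : ℂ) :
    ModularForm.eta z = Function.Periodic.qParam 24 z *
      qPoch (Function.Periodic.qParam 1 z) (Function.Periodic.qParam 1 z) := by
  rw [ModularForm.eta, qPoch_self_eq]

theorem sqrt_pow_eight (z : ℂ) : Complex.sqrt z ^ 8 = z ^ 4 := by
  rw [Complex.sqrt, ← Complex.cpow_nat_mul, show ((8 : ℕ) : ℂ) * 2⁻¹ = (4 : ℕ) by norm_num,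
    Complex.cpow_natCast]

/-- The inversion formula for the Dedekind eta function between `2i` and `i/2`. -/
theorem qPoch_exp_neg_pi :
    qPoch (cexp (-Real.pi)) (cexp (-Real.pi)) ^ 8 =
      16 * cexp (-Real.pi) * qPoch (cexp (-Real.pi) ^ 4) (cexp (-Real.pi) ^ 4) ^ 8 := by
  have hz : (2 * I) ∈ UpperHalfPlane.upperHalfPlaneSet := by
    simp [UpperHalfPlane.upperHalfPlaneSet]
  -- The eighth power removes the branch of the square root: the automorphy factor becomes (2i)⁴ =
  -- 16.
  have h := congrArg (· ^ 8) (ModularForm.eta_comp_eq_csqrt_I_inv hz)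
  have e1 : -1 / (2 * I) = I / 2 := by
    field_simp; rw [I_sq]
  simp only [Function.comp, Pi.smul_apply, Pi.mul_apply, smul_eq_mul, e1, eta_eq_qPoch, mul_pow,
    inv_pow, sqrt_pow_eight I, I_pow_four] at h
  have e3 : Function.Periodic.qParam 1 (I / 2) = cexp (-Real.pi) := by
    rw [Function.Periodic.qParam]
    congr 1
    push_cast
    linear_combination Real.pi * I_sq
  have e4 : Function.Periodic.qParam 1 (2 * I) = cexp (-Real.pi) ^ 4 := by
    rw [Function.Periodic.qParam, ← Complex.exp_nat_mul]
    congr 1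
    push_cast
    linear_combination 4 * Real.pi * I_sq
  have e5 : Function.Periodic.qParam 24 (I / 2) ^ 8 = cexp (-Real.pi / 3) := by
    rw [Function.Periodic.qParam, ← Complex.exp_nat_mul]
    congr 1
    push_cast
    linear_combination Real.pi / 3 * I_sq
  have e6 : Function.Periodic.qParam 24 (2 * I) ^ 8 = cexp (-Real.pi / 3) * cexp (-Real.pi) := by
    rw [Function.Periodic.qParam, ← Complex.exp_nat_mul, ← Complex.exp_add]
    congr 1
    push_cast
    linear_combination 4 * Real.pi / 3 * I_sq
  rw [sqrt_pow_eight (2 * I), e3, e4, e5, e6, mul_pow, I_pow_four] at h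
  refine mul_left_cancel₀ (Complex.exp_ne_zero (-Real.pi / 3)) (h.trans ?_)
  ring

end EtaInversion

/-! ### The lemniscatic period as a Beta integral -/

section Lemniscate

/-- This is B(1/4, 1/2) = Γ(1/4)Γ(1/2)/Γ(3/4), with Γ(3/4) eliminated by the reflection formula. -/
theorem betaIntegral_quarter_half :
    ∫ y in Set.Ioo (0 : ℝ) 1, y ^ (-(3 / 4) : ℝ) * (1 - y) ^ (-(1 / 2) : ℝ) =
      Real.Gamma (1 / 4) ^ 2 / Real.sqrt (2 * Real.pi) := by
  have h1 := Complex.Gamma_mul_Gamma_eq_betaIntegral (s := ((1 / 4 : ℝ) : ℂ))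
    (t := ((1 / 2 : ℝ) : ℂ)) (by simp) (by simp)
  have h2 : Complex.betaIntegral ((1 / 4 : ℝ) : ℂ) ((1 / 2 : ℝ) : ℂ) =
      ((∫ y in Set.Ioo (0 : ℝ) 1, y ^ (-(3 / 4) : ℝ) * (1 - y) ^ (-(1 / 2) : ℝ) : ℝ) : ℂ) := by
    rw [Complex.betaIntegral, intervalIntegral.integral_of_le zero_le_one,
      MeasureTheory.integral_Ioc_eq_integral_Ioo, ← integral_complex_ofReal]
    refine MeasureTheory.setIntegral_congr_fun measurableSet_Ioo fun y hy => ?_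
    have h0 : 0 ≤ 1 - y := by linarith [hy.2]
    rw [Complex.ofReal_mul, Complex.ofReal_cpow hy.1.le, Complex.ofReal_cpow h0]
    push_cast
    norm_num
  rw [h2, ← Complex.ofReal_add, Complex.Gamma_ofReal, Complex.Gamma_ofReal, Complex.Gamma_ofReal]
    at h1
  have h3 : Real.Gamma (1 / 4) * Real.Gamma (1 / 2) = Real.Gamma (1 / 4 + 1 / 2) *
      ∫ y in Set.Ioo (0 : ℝ) 1, y ^ (-(3 / 4) : ℝ) * (1 - y) ^ (-(1 / 2) : ℝ) := by
    exact_mod_cast h1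
  have h4 := Real.Gamma_mul_Gamma_one_sub (1 / 4)
  rw [show Real.pi * (1 / 4) = Real.pi / 4 by ring, Real.sin_pi_div_four,
    show (1 : ℝ) - 1 / 4 = 1 / 4 + 1 / 2 by norm_num] at h4
  have g1 : 0 < Real.Gamma (1 / 4) := Real.Gamma_pos_of_pos (by norm_num)
  have g2 : 0 < Real.Gamma (1 / 4 + 1 / 2) := Real.Gamma_pos_of_pos (by norm_num)
  rw [Real.Gamma_one_half_eq] at h3
  refine mul_left_cancel₀ g2.ne' (h3.symm.trans ?_)
  rw [Real.sqrt_mul two_pos.le]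
  have s2 : 0 < Real.sqrt 2 := by positivity
  have sp : 0 < Real.sqrt Real.pi := Real.sqrt_pos.mpr Real.pi_pos
  have q2 : Real.sqrt 2 ^ 2 = 2 := Real.sq_sqrt two_pos.le
  have qp : Real.sqrt Real.pi ^ 2 = Real.pi := Real.sq_sqrt Real.pi_pos.le
  rw [eq_div_iff (by positivity)] at h4
  rw [mul_div_assoc', eq_div_iff (by positivity)]
  linear_combination (Real.Gamma (1 / 4) * Real.sqrt 2) * qp +
    (-Real.sqrt 2 * Real.Gamma (1 / 4)) * h4 +
    (1 / 2 * Real.Gamma (1 / 4) ^ 2 * Real.Gamma (1 / 4 + 1 / 2)) * q2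

/-- The lemniscatic period: a solution of `f'² = κ² (1 - f⁴)` descending from `1` to `0` takes
time `B(1/4, 1/2) / (4 κ)`. -/
theorem integral_eq_of_lemniscatic {f f' : ℝ → ℝ} {κ b : ℝ} (hκ : 0 < κ) (hb : 0 < b)
    (hd : ∀ u, HasDerivAt f (f' u) u) (hode : ∀ u, f' u ^ 2 = κ ^ 2 * (1 - f u ^ 4))
    (h0 : f 0 = 1) (h1 : f b = 0) (hlt : ∀ u ∈ Set.Ioo 0 b, f u ^ 2 < 1) :
    ∫ y in Set.Ioo (0 : ℝ) 1, y ^ (-(3 / 4) : ℝ) * (1 - y) ^ (-(1 / 2) : ℝ) = 4 * κ * b := by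
  have hc : ContinuousOn f (Set.Icc 0 b) := fun u _ => (hd u).continuousAt.continuousWithinAt
  -- By Rolle, two equal values would give an interior zero of f', contradicting the differential
  -- equation where f² < 1.
  have hinj : Set.InjOn f (Set.Icc 0 b) := by
    intro x hx y hy hxy
    by_contra hne
    wlog hlt' : x < y generalizing x y
    · exact this hy hx hxy.symm (Ne.symm hne) (lt_of_le_of_ne (not_lt.mp hlt') (Ne.symm hne))
    obtain ⟨z, hz, hz0⟩ := exists_hasDerivAt_eq_zero hlt'
      (hc.mono (Set.Icc_subset_Icc hx.1 hy.2)) hxy fun u _ => hd u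
    have hz1 := hlt z ⟨hx.1.trans_lt hz.1, hz.2.trans_le hy.2⟩
    have hz2 := hode z
    rw [hz0] at hz2
    have : 0 < κ ^ 2 * (1 - f z ^ 4) := mul_pos (by positivity) (by nlinarith [sq_nonneg (f z)])
    linarith
  have hanti : StrictAntiOn f (Set.Icc 0 b) := by
    refine (hc.strictMonoOn_of_injOn_Icc' hb.le hinj).resolve_left fun h => ?_
    have := h (Set.left_mem_Icc.mpr hb.le) (Set.right_mem_Icc.mpr hb.le) hb
    linarith
  have hpos : ∀ u ∈ Set.Ioo 0 b, 0 < f u ∧ f u < 1 := fun u hu =>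
    ⟨h1 ▸ hanti (Set.Ioo_subset_Icc_self hu) (Set.right_mem_Icc.mpr hb.le) hu.2,
      h0 ▸ hanti (Set.left_mem_Icc.mpr hb.le) (Set.Ioo_subset_Icc_self hu) hu.1⟩
  have himg : (fun u => f u ^ 4) '' Set.Ioo 0 b = Set.Ioo 0 1 := by
    refine Set.Subset.antisymm ?_ ?_
    · rintro _ ⟨u, hu, rfl⟩
      obtain ⟨p0, p1⟩ := hpos u hu
      exact ⟨by positivity, pow_lt_one₀ p0.le p1 four_ne_zero⟩
    · have := intermediate_value_Ioo' hb.le (hc.pow 4)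
      simpa [h0, h1] using this
  have hinj4 : Set.InjOn (fun u => f u ^ 4) (Set.Ioo 0 b) := by
    intro x hx y hy hxy
    exact hinj (Set.Ioo_subset_Icc_self hx) (Set.Ioo_subset_Icc_self hy)
      ((pow_left_inj₀ (hpos x hx).1.le (hpos y hy).1.le four_ne_zero).mp hxy)
  -- Under y = f(u)⁴ the factor 4f³|f'| cancels the integrand down to the constant 4κ.
  rw [← himg, MeasureTheory.integral_image_eq_integral_abs_deriv_smul measurableSet_Ioo
    (fun u _ => ((hd u).fun_pow 4).hasDerivWithinAt) hinj4]
  rw [MeasureTheory.setIntegral_congr_fun (g := fun _ => 4 * κ) measurableSet_Ioo fun u hu => ?_]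
  · rw [MeasureTheory.setIntegral_const, MeasureTheory.measureReal_def, Real.volume_Ioo,
      ENNReal.toReal_ofReal (by linarith), smul_eq_mul]
    ring
  · obtain ⟨p0, p1⟩ := hpos u hu
    have hy : 0 < 1 - f u ^ 4 := by
      have := pow_lt_one₀ p0.le p1 four_ne_zero
      linarith
    have e1 : (f u ^ 4) ^ (-(3 / 4) : ℝ) = (f u ^ 3)⁻¹ := by
      rw [← Real.rpow_natCast, ← Real.rpow_mul p0.le, ← Real.rpow_natCast, ← Real.rpow_neg p0.le]
      norm_num
    have e2 : (1 - f u ^ 4) ^ (-(1 / 2) : ℝ) = (Real.sqrt (1 - f u ^ 4))⁻¹ := by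
      rw [Real.rpow_neg hy.le, Real.sqrt_eq_rpow]
    have e3 : |f' u| = κ * Real.sqrt (1 - f u ^ 4) := by
      rw [← Real.sqrt_sq_eq_abs, hode, Real.sqrt_mul (sq_nonneg κ), Real.sqrt_sq hκ.le]
    have hs : 0 < Real.sqrt (1 - f u ^ 4) := Real.sqrt_pos.mpr hy
    simp only [smul_eq_mul]
    rw [e1, e2, abs_mul, e3, abs_of_nonneg (by positivity)]
    norm_num
    field_simp

end Lemniscate

/-! ### Values of T and F at e^{-π} and e^{-2π} -/

section SpecialValues

theorem norm_cexp_neg_pi : ‖cexp (-Real.pi)‖ < 1 := by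
  rw [Complex.norm_exp]
  simpa using Real.pi_pos

theorem formT_neg_cexp_neg_pi : thetaSq (-cexp (-Real.pi)) ^ 2 = 16 * formF (cexp (-Real.pi)) := by
  have hp := norm_cexp_neg_pi
  have h2 := qPoch_self_ne_zero (norm_pow_lt_one hp two_ne_zero)
  rw [thetaSq_neg hp, formF_eq (Complex.exp_ne_zero _) hp, etaQuot, div_pow, ← pow_mul, ← pow_mul,
    qPoch_exp_neg_pi]
  ring

theorem formT_cexp_neg_pi : formT (cexp (-Real.pi)) = 32 * formF (cexp (-Real.pi)) := by
  have h := formF_eq_sub (Complex.exp_ne_zero (-Real.pi)) norm_cexp_neg_pi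
  rw [formT_neg_cexp_neg_pi] at h
  rw [formT_eq (Complex.exp_ne_zero _) norm_cexp_neg_pi]
  linear_combination -16 * h

variable {x : ℝ}

theorem norm_ofReal_lt_one (hx0 : 0 < x) (hx : x < 1) : ‖(x : ℂ)‖ < 1 := by
  rwa [Complex.norm_real, Real.norm_of_nonneg hx0.le]

theorem coshCoeff_ofReal (x : ℝ) (n : ℤ) :
    coshCoeff (x : ℂ) n = ((x ^ n / (1 + (x ^ n) ^ 2) : ℝ) : ℂ) := by
  rw [coshCoeff]; push_cast; ring

/-- A Fourier series with even real coefficients is real. -/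
theorem fser_ofReal {r : ℤ → ℝ} (hr : Rapid fun n => (r n : ℂ)) (he : ∀ n, r (-n) = r n) (u : ℝ) :
    HasSum (fun n : ℤ => r n * Real.cos (n * u)) (fser (fun n => (r n : ℂ)) u).re ∧
      fser (fun n => (r n : ℂ)) u = ((fser (fun n => (r n : ℂ)) u).re : ℂ) := by
  have h := hr.hasSum_fser u
  constructor
  · refine (Complex.hasSum_re h).congr_fun fun n => ?_
    rw [Complex.re_ofReal_mul, show I * (n : ℂ) * (u : ℂ) = ((n * u : ℝ) : ℂ) * I by
      push_cast; ring, Complex.exp_ofReal_mul_I_re]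
  · refine (Complex.conj_eq_iff_re.mp ?_).symm
    have h2 : fser (fun n => (r n : ℂ)) (-u) = fser (fun n => (r n : ℂ)) u :=
      fser_of_even (fun n => by rw [he]) u
    refine Eq.trans ?_ h2
    rw [fser, Complex.conj_tsum, fser]
    refine tsum_congr fun n => ?_
    rw [map_mul, Complex.conj_ofReal, ← Complex.exp_conj]
    simp

/-- The square of the lemniscatic half period. -/
theorem jacW_sub_sq (hx0 : 0 < x) (hx : x < 1)
    (h : ((jacW x 0 + jacW x Real.pi) / 2) ^ 2 = 2 * ((jacW x 0 - jacW x Real.pi) / 2) ^ 2) :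
    ((jacW x 0 - jacW x Real.pi) / 2) ^ 2 =
      ((Real.Gamma (1 / 4) ^ 4 / (32 * Real.pi ^ 3) : ℝ) : ℂ) := by
  have hq0 : (x : ℂ) ≠ 0 := by exact_mod_cast hx0.ne'
  have hq := norm_ofReal_lt_one hx0 hx
  set r : ℤ → ℝ := fun n => if Odd n then x ^ n / (1 + (x ^ n) ^ 2) else 0 with hr
  have hrc : (fun n => (r n : ℂ)) = fun n => if Odd n then coshCoeff x n else 0 := by
    funext n
    simp only [hr, coshCoeff_ofReal]
    split_ifs <;> simp
  have hrR : Rapid fun n => (r n : ℂ) := by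
    rw [hrc]; exact (rapid_coshCoeff hq0 hq).ite _
  have hre : ∀ n, r (-n) = r n := by
    intro n
    have := congrFun hrc (-n)
    simp only [coshCoeff_neg hq0, odd_neg] at this
    exact_mod_cast this.trans (congrFun hrc n).symm
  have hr0 : ∀ n, 0 ≤ r n := by
    intro n
    simp only [hr]
    split_ifs <;> positivity
  have hr1 : 0 < r 1 := by
    simp only [hr, odd_one, if_true]
    positivity
  set C : ℝ → ℂ := fun u => (jacW x u - jacW x (u + Real.pi)) / 2 with hC
  have hCf : ∀ u, C u = fser (fun n => (r n : ℂ)) u := by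
    intro u
    have := (rapid_coshCoeff hq0 hq).fser_sub_fser_add_pi u
    rw [hrc]
    simp only [hC, jacW]
    rw [this]; ring
  have hsum : ∀ u, HasSum (fun n : ℤ => r n * Real.cos (n * u)) (C u).re := fun u => by
    rw [hCf]; exact (fser_ofReal hrR hre u).1
  have hreal : ∀ u, C u = ((C u).re : ℂ) := fun u => by
    rw [hCf]; exact (fser_ofReal hrR hre u).2
  set c := (C 0).re with hc
  have hsum0 : HasSum r c := (hsum 0).congr_fun fun n => by simp
  have hc0 : 0 < c := hasSum_lt (i := 1) hr0 hr1 hasSum_zero hsum0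
  have hCd : ∀ u, HasDerivAt C (I * jacS x u * (jacW x u + jacW x (u + Real.pi))) u := fun u =>
    (((hasDerivAt_jacW hq0 hq u).sub (hasDerivAt_jacW_add_pi hq0 hq u)).div_const 2).congr_deriv
      (by ring)
  set C' : ℝ → ℂ := fun u => I * jacS x u * (jacW x u + jacW x (u + Real.pi)) with hC'
  have hred : ∀ u, HasDerivAt (fun u => (C u).re) (C' u).re u := fun u =>
    Complex.reCLM.hasFDerivAt.comp_hasDerivAt u (hCd u)
  have hC'real : ∀ u, C' u = ((C' u).re : ℂ) := by
    intro u
    have h1 : HasDerivAt C (((C' u).re : ℝ) : ℂ) u := by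
      have := (hred u).ofReal_comp
      exact this.congr_of_eventuallyEq (Eventually.of_forall hreal)
    exact (hCd u).unique h1
  have h0c : (c : ℂ) = (jacW x 0 - jacW x Real.pi) / 2 := by
    rw [hc, ← hreal 0]; simp only [hC, zero_add]
  -- The hypothesis `h` amounts to W(0)W(π) = c². The first integrals then read S² = C² - c² and
  -- (W(u) + W(u+π))² = 4(C² + c²), so the middle term of the quartic disappears.
  have hode : ∀ u, C' u ^ 2 = 4 * ((c : ℂ) ^ 4 - C u ^ 4) := by
    intro u
    have e1 := jacW_mul_jacW_add_pi hq0 hq u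
    have e2 := jacW_sq_add hq0 hq u
    have e3 : jacS x u ^ 2 = C u ^ 2 - (c : ℂ) ^ 2 := by
      simp only [hC, h0c]
      linear_combination -1 / 4 * e2 + 1 / 2 * e1
    have e4 : (jacW x u + jacW x (u + Real.pi)) ^ 2 = 4 * (C u ^ 2 + (c : ℂ) ^ 2) := by
      simp only [hC, h0c]
      linear_combination 4 * e1 + 4 * h
    simp only [hC']
    rw [mul_pow, mul_pow, I_sq, e3, e4]; ring
  have hode' : ∀ u, (C' u).re ^ 2 = 4 * (c ^ 4 - (C u).re ^ 4) := by
    intro u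
    have := hode u
    rw [hC'real u, hreal u] at this
    exact_mod_cast this
  have hhalf : C (Real.pi / 2) = 0 := by
    simp only [hC, (jacW_half_pi hq0 hq).1, (jacW_half_pi hq0 hq).2, sub_self, zero_div]
  -- C is a cosine series with nonnegative coefficients, compared termwise with its value at 0; the
  -- term n = 1 makes both inequalities strict.
  have hlt : ∀ u ∈ Set.Ioo 0 (Real.pi / 2), (C u).re ^ 2 < c ^ 2 := by
    intro u hu
    have hcos0 : 0 < Real.cos u := Real.cos_pos_of_mem_Ioo ⟨by linarith [hu.1, Real.pi_pos], hu.2⟩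
    have hcos1 : Real.cos u < 1 := by
      have := Real.cos_lt_cos_of_nonneg_of_le_pi le_rfl (by linarith [hu.2, Real.pi_pos]) hu.1
      rwa [Real.cos_zero] at this
    have u1 : (C u).re < c := by
      refine hasSum_lt (i := 1) (fun n => ?_) ?_ (hsum u) hsum0
      · exact mul_le_of_le_one_right (hr0 n) (Real.cos_le_one _)
      · simp only [Int.cast_one, one_mul]
        exact mul_lt_of_lt_one_right hr1 hcos1
    have u2 : -c < (C u).re := by
      refine hasSum_lt (i := 1) (fun n => ?_) ?_ hsum0.neg (hsum u)
      · have := mul_le_mul_of_nonneg_left (Real.neg_one_le_cos (n * u)) (hr0 n)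
        linarith
      · simp only [Int.cast_one, one_mul]
        have := mul_pos hr1 hcos0
        linarith
    exact sq_lt_sq' u2 u1
  have hint := integral_eq_of_lemniscatic (f := fun u => (C u).re / c)
    (f' := fun u => (C' u).re / c) (κ := 2 * c) (b := Real.pi / 2) (by positivity)
    (by linarith [Real.pi_pos]) (fun u => (hred u).div_const c) (fun u => ?_) ?_ ?_ ?_
  · rw [betaIntegral_quarter_half, div_eq_iff (by have := Real.pi_pos; positivity)] at hint
    have hs : Real.sqrt (2 * Real.pi) ^ 2 = 2 * Real.pi :=
      Real.sq_sqrt (by linarith [Real.pi_pos])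
    rw [← h0c]
    have : c ^ 2 = Real.Gamma (1 / 4) ^ 4 / (32 * Real.pi ^ 3) := by
      rw [eq_div_iff (by have := Real.pi_pos; positivity),
        show Real.Gamma (1 / 4) ^ 4 = (Real.Gamma (1 / 4) ^ 2) ^ 2 by ring, hint]
      linear_combination (-16 * Real.pi ^ 2 * c ^ 2) * hs
    exact_mod_cast this
  · simp only [div_pow, hode']
    field_simp
    ring
  · exact div_self hc0.ne'
  · simp only [hhalf, Complex.zero_re, zero_div]
  · intro u hu
    rw [div_pow, div_lt_one (by positivity)]
    exact hlt u hu

theorem formT_value : formT (cexp (-Real.pi)) =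
    ((Real.Gamma (1 / 4) ^ 4 / Real.pi ^ 3 / 4 : ℝ) : ℂ) := by
  -- By the mean step, T = 32F at x² is exactly the lemniscatic condition at x; hence the square
  -- root of e^{-π}.
  set x := Real.exp (-Real.pi / 2) with hx
  have hx0 : 0 < x := Real.exp_pos _
  have hx1 : x < 1 := by rw [hx, Real.exp_lt_one_iff]; linarith [Real.pi_pos]
  have hq0 : (x : ℂ) ≠ 0 := by exact_mod_cast hx0.ne'
  have hq := norm_ofReal_lt_one hx0 hx1
  have hxx : (x : ℂ) ^ 2 = cexp (-Real.pi) := by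
    rw [hx, Complex.ofReal_exp, ← Complex.exp_nat_mul]
    congr 1
    push_cast; ring
  have h := formT_cexp_neg_pi
  rw [← hxx, formT, formF, jacW_sq_pi hq0 hq, jacW_sq_zero hq0 hq] at h
  have h1 := jacW_sub_sq hx0 hx1 (by linear_combination 1 / 4 * h)
  rw [← hxx, formT, jacW_sq_zero hq0 hq]
  have h2 : 4 * ((jacW x 0 + jacW x Real.pi) / 2) ^ 2 =
      8 * ((jacW x 0 - jacW x Real.pi) / 2) ^ 2 := by linear_combination h
  rw [h2, h1]
  push_cast
  field_simp
  ring

theorem jacW_zero_pos (hx0 : 0 < x) (hx : x < 1) : ∃ w : ℝ, 0 < w ∧ jacW x 0 = w := by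
  have hs : Summable fun n : ℤ => ((x ^ n / (1 + (x ^ n) ^ 2) : ℝ) : ℂ) :=
    (rapid_coshCoeff (q := x) (by exact_mod_cast hx0.ne')
      (norm_ofReal_lt_one hx0 hx)).summable.congr fun n => coshCoeff_ofReal x n
  refine ⟨∑' n : ℤ, x ^ n / (1 + (x ^ n) ^ 2),
    (Complex.summable_ofReal.mp hs).tsum_pos (fun n => by positivity) 0 (by positivity), ?_⟩
  rw [jacW, fser_zero, Complex.ofReal_tsum]
  exact tsum_congr fun n => coshCoeff_ofReal x n

/-- The series at π alternates in sign, so positivity is taken from the exponential formula. It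
fixes the sign when a square root is extracted in `form_values_sq`. -/
theorem jacW_pi_pos (hx0 : 0 < x) (hx : x < 1) : ∃ w : ℝ, 0 < w ∧ jacW x Real.pi = w := by
  obtain ⟨w, hw, h⟩ := jacW_zero_pos hx0 hx
  refine ⟨w * Real.exp (-2 * ∑' n : ℤ,
    2 * (if Odd n then x ^ n / (1 - (x ^ n) ^ 2) else 0) / (n : ℝ)),
    by positivity, ?_⟩
  rw [jacW_pi_eq_mul_exp (by exact_mod_cast hx0.ne') (norm_ofReal_lt_one hx0 hx), h]
  push_cast
  congr 3
  refine tsum_congr fun n => ?_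
  rw [oddSinhCoeff, sinhCoeff]
  split_ifs <;> simp

theorem form_values_sq : formT (cexp (-Real.pi) ^ 2) =
      ((Real.Gamma (1 / 4) ^ 4 / Real.pi ^ 3 / (32 * (Real.sqrt 2 - 1) ^ 2) : ℝ) : ℂ) ∧
    formF (cexp (-Real.pi) ^ 2) =
      ((Real.Gamma (1 / 4) ^ 4 / Real.pi ^ 3 * (Real.sqrt 2 - 1) ^ 2 / 512 : ℝ) : ℂ) := by
  set x := Real.exp (-Real.pi) with hx
  have hx0 : 0 < x := Real.exp_pos _
  have hx1 : x < 1 := by rw [hx, Real.exp_lt_one_iff]; linarith [Real.pi_pos]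
  have hq0 : (x : ℂ) ≠ 0 := by exact_mod_cast hx0.ne'
  have hq := norm_ofReal_lt_one hx0 hx1
  have hxx : cexp (-Real.pi) = x := by rw [hx, Complex.ofReal_exp, Complex.ofReal_neg]
  obtain ⟨w, hw, hw0⟩ := jacW_zero_pos hx0 hx1
  obtain ⟨v, hv, hv0⟩ := jacW_pi_pos hx0 hx1
  have h1 := formT_value
  have h2 := formT_cexp_neg_pi
  rw [hxx, formT, formF, hw0, hv0] at h2
  rw [hxx, formT, hw0] at h1
  rw [hxx, formT, formF, jacW_sq_pi hq0 hq, jacW_sq_zero hq0 hq, hw0, hv0]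
  generalize Real.Gamma (1 / 4) ^ 4 / Real.pi ^ 3 = X at *
  have h1' : 4 * w ^ 2 = X / 4 := by exact_mod_cast h1
  have h2' : 4 * w ^ 2 = 32 * ((w ^ 2 - v ^ 2) / 4) := by exact_mod_cast h2
  have s0 : 0 < Real.sqrt 2 := by positivity
  have s2 : Real.sqrt 2 ^ 2 = 2 := Real.sq_sqrt two_pos.le
  -- T = 32F at e^{-π} says w² = 2v²; one mean step from (√2 v, v) then yields the factors √2 ± 1.
  have hwv : w = Real.sqrt 2 * v := by
    rw [← pow_left_inj₀ hw.le (by positivity) two_ne_zero, mul_pow, s2]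
    linarith
  have s1 : 1 < Real.sqrt 2 := by
    rw [Real.lt_sqrt zero_le_one]; norm_num
  have hX : X = 32 * v ^ 2 := by
    rw [hwv, mul_pow, s2] at h1'; linarith
  generalize Real.sqrt 2 = s at *
  have hs : 0 < s - 1 := by linarith
  constructor
  · have : 4 * ((w + v) / 2) ^ 2 = X / (32 * (s - 1) ^ 2) := by
      rw [eq_div_iff (by positivity), hX, hwv]
      linear_combination (32 * v ^ 2 * s ^ 2) * s2
    exact_mod_cast this
  · have : (((w + v) / 2) ^ 2 - w * v) / 4 = X * (s - 1) ^ 2 / 512 := by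
      rw [hX, hwv]; ring
    exact_mod_cast this

end SpecialValues

/-! ### Existence and uniqueness of the coefficients -/

section CuspCoefficients

variable {q : ℂ} {k : ℕ}

/-- The eta quotients in `IsCuspCoeff` are the powers of the Hauptmodul `formF / formT`. -/
theorem hauptmodul_pow (hq0 : q ≠ 0) (hq : ‖q‖ < 1) (j : ℕ) :
    q ^ j * qPoch (q ^ 4) (q ^ 4) ^ (16 * j) * qPoch q q ^ (8 * j) /
      qPoch (q ^ 2) (q ^ 2) ^ (24 * j) = (formF q / formT q) ^ j := by
  have h1 := qPoch_self_ne_zero hq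
  have h2 := qPoch_self_ne_zero (norm_pow_lt_one hq two_ne_zero)
  have h4 := qPoch_self_ne_zero (norm_pow_lt_one hq four_ne_zero)
  rw [formF_eq hq0 hq, formT_eq hq0 hq, etaQuot, thetaSq, pow_mul, pow_mul, pow_mul, ← mul_pow,
    ← mul_pow, ← div_pow]
  congr 1
  field_simp

theorem isCuspCoeff_iff_of_ne_zero (hq0 : q ≠ 0) (hq : ‖q‖ < 1) (α : ℕ → ℚ) :
    (∑ j ∈ Finset.Icc 1 (k - 1), (α j : ℂ) *
        (q ^ j * qPoch (q ^ 4) (q ^ 4) ^ (16 * j) * qPoch q q ^ (8 * j)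
          / qPoch (q ^ 2) (q ^ 2) ^ (24 * j)) =
      (G k q - (Z k : ℂ) *
          (q ^ k * qPoch (q ^ 4) (q ^ 4) ^ (8 * k) / qPoch (q ^ 2) (q ^ 2) ^ (4 * k))) *
        (qPoch q q ^ (8 * k) * qPoch (q ^ 4) (q ^ 4) ^ (8 * k)
          / qPoch (q ^ 2) (q ^ 2) ^ (20 * k))) ↔
      ∑ j ∈ Finset.Icc 1 (k - 1), (α j : ℂ) * (formF q / formT q) ^ j =
        (G k q - (Z k : ℂ) * formF q ^ k) / formT q ^ k := by
  have h1 := qPoch_self_ne_zero hq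
  have h2 := qPoch_self_ne_zero (norm_pow_lt_one hq two_ne_zero)
  have h4 := qPoch_self_ne_zero (norm_pow_lt_one hq four_ne_zero)
  have e1 : q ^ k * qPoch (q ^ 4) (q ^ 4) ^ (8 * k) / qPoch (q ^ 2) (q ^ 2) ^ (4 * k) =
      formF q ^ k := by
    rw [formF_eq hq0 hq, etaQuot, pow_mul, pow_mul, mul_pow, div_pow, mul_div_assoc]
  have e2 : qPoch q q ^ (8 * k) * qPoch (q ^ 4) (q ^ 4) ^ (8 * k) /
      qPoch (q ^ 2) (q ^ 2) ^ (20 * k) = (formT q ^ k)⁻¹ := by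
    rw [formT_eq hq0 hq, thetaSq, pow_mul, pow_mul, pow_mul, ← mul_pow, ← div_pow, ← inv_pow]
    congr 1
    field_simp
  simp only [hauptmodul_pow hq0 hq, e1, e2, div_eq_mul_inv]

theorem G_zero (k : ℕ) : G k 0 = 0 := by
  rw [G]
  refine (tsum_congr fun n => ?_).trans tsum_zero
  rw [term]
  split_ifs <;> simp

theorem formT_ne_zero (hq0 : q ≠ 0) (hq : ‖q‖ < 1) : formT q ≠ 0 := by
  rw [formT_eq hq0 hq]; exact pow_ne_zero 2 (thetaSq_ne_zero hq)

theorem formF_ne_zero (hq0 : q ≠ 0) (hq : ‖q‖ < 1) : formF q ≠ 0 := by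
  rw [formF_eq hq0 hq]; exact mul_ne_zero hq0 (etaQuot_ne_zero hq)

theorem isCuspCoeff_of_eq_sum (hk : 0 < k) {α : ℕ → ℚ} (h : ∀ q : ℂ, q ≠ 0 → ‖q‖ < 1 →
    G k q = ∑ j ∈ Finset.Icc 1 (k - 1), (α j : ℂ) * (formF q ^ j * formT q ^ (k - j)) +
      (Z k : ℂ) * formF q ^ k) : IsCuspCoeff k α := by
  intro q hq
  rcases eq_or_ne q 0 with rfl | hq0
  · rw [G_zero k, Finset.sum_eq_zero]
    · simp [hk.ne']
    · intro j hj
      have : j ≠ 0 := by have := (Finset.mem_Icc.mp hj).1; lia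
      simp [this]
  · have hT := formT_ne_zero hq0 hq
    rw [isCuspCoeff_iff_of_ne_zero hq0 hq, h q hq0 hq, add_sub_cancel_right, Finset.sum_div]
    refine Finset.sum_congr rfl fun j hj => ?_
    have hj' := Finset.mem_Icc.mp hj
    rw [show formT q ^ k = formT q ^ j * formT q ^ (k - j) by rw [← pow_add]; congr 1; lia,
      div_pow]
    field_simp

theorem tendsto_formF_div_formT :
    Tendsto (fun q => formF q / formT q) (𝓝[≠] 0) (𝓝 0) := by
  have hB : Metric.ball (0 : ℂ) 1 ∈ 𝓝 (0 : ℂ) := Metric.ball_mem_nhds 0 one_pos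
  have h1 : Tendsto (fun q : ℂ => q * etaQuot q / thetaSq q ^ 2) (𝓝 0) (𝓝 0) := by
    have := (tendsto_id (x := 𝓝 (0 : ℂ))).mul
      (differentiableOn_etaQuot.continuousOn.continuousAt hB).tendsto |>.div
      ((differentiableOn_thetaSq.continuousOn.continuousAt hB).tendsto.pow 2)
      (by simp [thetaSq_zero])
    simp only [id, zero_mul, zero_div] at this
    exact this
  refine (h1.mono_left nhdsWithin_le_nhds).congr' ?_
  filter_upwards [self_mem_nhdsWithin, nhdsWithin_le_nhds hB] with q hq0 hq
  rw [mem_ball_zero_iff] at hq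
  rw [formF_eq hq0 hq, formT_eq hq0 hq]

/-- The difference of two solutions is a polynomial vanishing at every value of F/T. These values
are nonzero and tend to 0 as q → 0, so they form an infinite set. -/
theorem IsCuspCoeff.unique {α β : ℕ → ℚ} (hα : IsCuspCoeff k α) (hβ : IsCuspCoeff k β) :
    ∀ j ∈ Finset.Icc 1 (k - 1), β j = α j := by
  set P : Polynomial ℂ := ∑ j ∈ Finset.Icc 1 (k - 1),
    Polynomial.C ((β j : ℂ) - α j) * Polynomial.X ^ j with hP
  have hroot : ∀ q : ℂ, q ≠ 0 → ‖q‖ < 1 → P.IsRoot (formF q / formT q) := by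
    intro q hq0 hq
    have h1 := (isCuspCoeff_iff_of_ne_zero hq0 hq α).mp (hα q hq)
    have h2 := (isCuspCoeff_iff_of_ne_zero hq0 hq β).mp (hβ q hq)
    rw [Polynomial.IsRoot, hP, Polynomial.eval_finsetSum]
    simp only [Polynomial.eval_mul, Polynomial.eval_C, Polynomial.eval_pow, Polynomial.eval_X,
      sub_mul, Finset.sum_sub_distrib]
    rw [h1, h2, sub_self]
  have hP0 : P = 0 := by
    refine Polynomial.eq_zero_of_infinite_isRoot P fun hfin => ?_
    -- P has no constant term, so 0 is itself a root; it is removed so that the complement of the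
    -- other roots is a neighbourhood of 0.
    have hfin' : ({x | P.IsRoot x} \ {0}).Finite := hfin.subset Set.sdiff_subset
    have h0 : ({x | P.IsRoot x} \ {0})ᶜ ∈ 𝓝 (0 : ℂ) :=
      hfin'.isClosed.isOpen_compl.mem_nhds (by simp)
    have h1 := tendsto_formF_div_formT.eventually h0
    have h2 : ∀ᶠ q : ℂ in 𝓝[≠] 0, q ∈ Metric.ball (0 : ℂ) 1 :=
      nhdsWithin_le_nhds (Metric.ball_mem_nhds 0 one_pos)
    obtain ⟨q, ⟨hq1, hq2⟩, hq0⟩ := ((h1.and h2).and self_mem_nhdsWithin).exists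
    rw [mem_ball_zero_iff] at hq2
    exact hq1 ⟨hroot q hq0 hq2, div_ne_zero (formF_ne_zero hq0 hq2) (formT_ne_zero hq0 hq2)⟩
  intro j hj
  have h := congrArg (fun Q => Polynomial.coeff Q j) hP0
  simp only [hP, Polynomial.finsetSum_coeff, Polynomial.coeff_C_mul_X_pow,
    Polynomial.coeff_zero, Finset.sum_ite_eq, if_pos hj] at h
  exact_mod_cast sub_eq_zero.mp h

end CuspCoefficients

end Goswami

end

/-! ### The main theorem: substitution of the special values -/

theorem corollary1p2 (k : ℕ) (hk : 0 < k) :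
    ∃ α : ℕ → ℚ,
      Goswami.IsCuspCoeff k α ∧
      (∀ β : ℕ → ℚ, Goswami.IsCuspCoeff k β → ∀ j ∈ Finset.Icc 1 (k - 1), β j = α j) ∧
      Goswami.G k ((Real.exp (-Real.pi) : ℝ) : ℂ) =
        (((((Goswami.Z k : ℝ) / 2 ^ (7 * k) +
            1 / 2 ^ (2 * k) * ∑ j ∈ Finset.Icc 1 (k - 1), (α j : ℝ) / 2 ^ (5 * j)) *
          (Real.Gamma (1 / 4) ^ 4 / Real.pi ^ 3) ^ k : ℝ)) : ℂ) ∧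
      Goswami.G k ((Real.exp (-2 * Real.pi) : ℝ) : ℂ) =
        (((((Goswami.Z k : ℝ) * (Real.sqrt 2 - 1) ^ (2 * k) / 2 ^ (9 * k) +
            1 / (2 ^ (5 * k) * (Real.sqrt 2 - 1) ^ (2 * k)) *
              ∑ j ∈ Finset.Icc 1 (k - 1),
                (α j : ℝ) * (Real.sqrt 2 - 1) ^ (4 * j) / 2 ^ (4 * j)) *
          (Real.Gamma (1 / 4) ^ 4 / Real.pi ^ 3) ^ k : ℝ)) : ℂ) := by
  obtain ⟨α, hα⟩ := Goswami.exists_G_eq_sum hk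
  have hcusp := Goswami.isCuspCoeff_of_eq_sum hk hα
  refine ⟨α, hcusp, fun β hβ => hcusp.unique hβ, ?_, ?_⟩
  · have hT := Goswami.formT_value
    have hF : Goswami.formF (Complex.exp (-Real.pi)) =
        ((Real.Gamma (1 / 4) ^ 4 / Real.pi ^ 3 / 128 : ℝ) : ℂ) := by
      have h := Goswami.formT_cexp_neg_pi
      rw [hT] at h
      push_cast at h ⊢
      linear_combination -1 / 32 * h
    rw [Complex.ofReal_exp, Complex.ofReal_neg,
      hα _ (Complex.exp_ne_zero _) Goswami.norm_cexp_neg_pi, hT, hF]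
    generalize Real.Gamma (1 / 4) ^ 4 / Real.pi ^ 3 = x
    simp only [← Complex.ofReal_ratCast, ← Complex.ofReal_pow, ← Complex.ofReal_mul,
      ← Complex.ofReal_sum, ← Complex.ofReal_add]
    congr 1
    rw [add_comm, add_mul, Finset.mul_sum, Finset.sum_mul]
    congr 1
    · rw [div_pow, pow_mul]; norm_num; ring
    · refine Finset.sum_congr rfl fun j hj => ?_
      obtain ⟨m, rfl⟩ : ∃ m, k = j + m :=
        Nat.exists_eq_add_of_le (by have := Finset.mem_Icc.mp hj; lia)
      rw [Nat.add_sub_cancel_left, div_pow, div_pow, pow_mul, pow_mul, pow_add, pow_add,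
        show (2 : ℝ) ^ 2 = 4 by norm_num, show (2 : ℝ) ^ 5 = 32 by norm_num,
        show (128 : ℝ) = 4 * 32 by norm_num, mul_pow]
      field_simp
  · obtain ⟨hT, hF⟩ := Goswami.form_values_sq
    have hs : Real.sqrt 2 - 1 ≠ 0 := by
      have : 1 < Real.sqrt 2 := by rw [Real.lt_sqrt zero_le_one]; norm_num
      linarith
    have he : ((Real.exp (-2 * Real.pi) : ℝ) : ℂ) = Complex.exp (-Real.pi) ^ 2 := by
      rw [Complex.ofReal_exp, ← Complex.exp_nat_mul]
      congr 1
      push_cast; ring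
    rw [he, hα _ (pow_ne_zero 2 (Complex.exp_ne_zero _))
      (Goswami.norm_pow_lt_one Goswami.norm_cexp_neg_pi two_ne_zero), hT, hF]
    generalize Real.Gamma (1 / 4) ^ 4 / Real.pi ^ 3 = x
    generalize Real.sqrt 2 - 1 = s at *
    simp only [← Complex.ofReal_ratCast, ← Complex.ofReal_pow, ← Complex.ofReal_mul,
      ← Complex.ofReal_sum, ← Complex.ofReal_add]
    congr 1
    rw [add_comm, add_mul, Finset.mul_sum, Finset.sum_mul]
    congr 1
    · rw [div_pow, mul_pow, pow_mul, pow_mul]; norm_num; ring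
    · refine Finset.sum_congr rfl fun j hj => ?_
      obtain ⟨m, rfl⟩ : ∃ m, k = j + m :=
        Nat.exists_eq_add_of_le (by have := Finset.mem_Icc.mp hj; lia)
      rw [Nat.add_sub_cancel_left, div_pow, div_pow, mul_pow, mul_pow, pow_mul, pow_mul, pow_mul,
        pow_mul, pow_add, pow_add, pow_add, show (2 : ℝ) ^ 5 = 32 by norm_num,
        show (2 : ℝ) ^ 4 = 16 by norm_num, show (512 : ℝ) = 16 * 32 by norm_num, mul_pow,
        show (s ^ 4) ^ j = (s ^ 2) ^ j * (s ^ 2) ^ j by rw [← mul_pow]; ring]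
      field_simp
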